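/- Let $\Gamma$ be a countable (discrete) abelian group with dual group $\widehat\Gamma$ (equipped with its Borel sets and a Haar measure $\mu$; $L^2(E)$ means $L^2(E,\mu)$), and let $\alpha:\Gamma\to\Gamma$ be an injective homomorphism such that $N=[\Gamma:\alpha(\Gamma)]$ satisfies $1<N<\infty$ and $\bigcap_{n}\alpha^n(\Gamma)$ is trivial. Let $\alpha^*$ be the dual endomorphism of $\widehat\Gamma$, $[\alpha^*(\omega)](\gamma)=\omega(\alpha(\gamma))$, let $c:\widehat\Gamma\to\widehat\Gamma$ be a Borel map with $\alpha^*(c(\omega))=\omega$ for all $\omega$, and put $\tau(\omega)=c(\alpha^*(\omega))\omega^{-1}\in\ker\alpha^*$. Identities and inequalities between functions on $\widehat\Gamma$ are understood almost everywhere. Let $m:\widehat\Gamma\to\{0,1,2,\dots\}$ be a Borel function with $m(\omega)\le\sum_{\alpha^*(\zeta)=\omega}m(\zeta)$ (the consistency inequality), put $\widetilde m(\omega)=\sum_{\alpha^*(\zeta)=\omega}m(\zeta)-m(\omega)$, and for $i,k\ge 1$ put $\sigma_i=\{m\ge i\}$ and $\widetilde\sigma_k=\{\widetilde m\ge k\}$.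 Let $H=[h_{i,j}]$ and $G=[g_{k,j}]$ be matrices of Borel functions $\widehat\Gamma\to\mathbb C$ (with $i,j,k\geq 1$), with $h_{i,j}$ and $g_{k,j}$ supported in $\sigma_j$, satisfying $$\sum_{\alpha^*(\zeta)=\omega}\sum_j h_{i,j}(\zeta)\overline{h_{i',j}(\zeta)}=N\delta_{i,i'}\chi_{\sigma_i}(\omega),\quad \sum_{\alpha^*(\zeta)=\omega}\sum_j g_{k,j}(\zeta)\overline{g_{k',j}(\zeta)}=N\delta_{k,k'}\chi_{\widetilde\sigma_k}(\omega),\quad \sum_{\alpha^*(\zeta)=\omega}\sum_j g_{k,j}(\zeta)\overline{h_{i,j}(\zeta)}=0$$ (so $H$ is a filter relative to $m$ and $\alpha^*$, and $G$ is a complementary filter to $H$). The Ruelle operators $S_H:\bigoplus_iL^2(\sigma_i)\to\bigoplus_jL^2(\sigma_j)$ and $S_G:\bigoplus_kL^2(\widetilde\sigma_k)\to\bigoplus_jL^2(\sigma_j)$ are given by $[S_Hf](\omega)=H^t(\omega)f(\alpha^*(\omega))$ and $[S_Gf](\omega)=G^t(\omega)f(\alpha^*(\omega))$. Suppose that $S_H$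 is a pure isometry, i.e. an isometry with $\bigcap_n S_H^n\big(\bigoplus_iL^2(\sigma_i)\big)=\{0\}$. For a family of Borel measures $\nu_i$ on $\widehat\Gamma$, let $\nu'_{i,\zeta}$ ($\zeta\in\ker\alpha^*$) be $N$ times the image under $\alpha^*$ of the restriction of $\nu_i$ to $\{\tau=\zeta\}$, and let the dilation $\mathcal D$ of $\mathcal K=\bigoplus_iL^2(\nu_i)$ to $\mathcal K'=\bigoplus_{i,\zeta}L^2(\nu'_{i,\zeta})$ be $[\mathcal D(f)]_{i,\zeta}(\omega)=\frac1{\sqrt N}f_i(\zeta^{-1}c(\omega))$. Put $\mathcal V_0=\bigoplus_iL^2(\sigma_i)$, $\mathcal W_0=\bigoplus_kL^2(\widetilde\sigma_k)$, let $\mathcal W_n=\mathcal D(\mathcal W_{n-1})$ ($n\ge1$) be the dilation $\mathcal K'$ of $\mathcal K=\mathcal W_{n-1}$, and let $\mathcal H=\mathcal V_0\oplus\bigoplus_{n=0}^\infty\mathcal W_n$. Let $[\pi_\gamma(f)](\omega)=\omega(\gamma)f(\omega)$ for $\gamma\in\Gamma$ and $f\in\mathcal H$, and define $T$ on $\mathcal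 H$ by $$[T(f)]_{\mathcal V_0}=S_H(f_{\mathcal V_0})+S_G(f_{\mathcal W_0}),\qquad [T(f)]_{\mathcal W_n}=\mathcal D^{-1}(f_{\mathcal W_{n+1}})\quad(n\ge0).$$ Then each $\mathcal D:\mathcal W_n\to\mathcal W_{n+1}$ is an isometry onto, $\pi$ is a unitary representation of $\Gamma$ on $\mathcal H$, and: 1. $T$ is a unitary operator on $\mathcal H$. 2. $T\pi_\gamma T^{-1}=\pi_{\alpha(\gamma)}$ for all $\gamma\in\Gamma$. 3. With $\delta=T^{-1}$, the subspaces $\mathcal V_j=T^{-j}(\mathcal V_0)$, $j\in\mathbb Z$, form a generalized multiresolution analysis (GMRA) in the separable Hilbert space $\mathcal H$ relative to $\pi$ and $\delta$: they are closed, $\mathcal V_j\subseteq\mathcal V_{j+1}$ and $\mathcal V_{j+1}=\delta(\mathcal V_j)$ for all $j$, $\bigcap_j\mathcal V_j=\{0\}$, $\bigcup_j\mathcal V_j$ is dense in $\mathcal H$, and $\mathcal V_0$ is invariant under $\pi$. 4. The multiplicity function associated to the core subspace $\mathcal V_0$ is $m$, that is, there is a unitary $J:\mathcal V_0\to\bigoplus_iL^2(\sigma_i)$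 with $[J(\pi_\gamma f)](\omega)=\omega(\gamma)[Jf](\omega)$ for all $\gamma\in\Gamma$ and $f\in\mathcal V_0$; and $H$ is a filter constructed from this GMRA, that is, for some such $J$ and all $i$, $J(\delta^{-1}(J^{-1}(C_i)))=\bigoplus_jh_{i,j}$, where $C_i\in\bigoplus_jL^2(\sigma_j)$ has $i$-th coordinate $\chi_{\sigma_i}$ and all other coordinates $0$. -/

import Mathlib

open MeasureTheory
open scoped ENNReal ComplexConjugate

noncomputable section

namespace GMRA

universe u v

/-! ### Hilbert space direct sums of `L²` spaces -/

section DirectSum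

variable {X : Type u} [MeasurableSpace X]

/-- The Hilbert space direct sum `⨁ᵢ L²(νᵢ)` of complex `L²` spaces.  The space `L²(E, ν)` of a
subset `E` is the `L²` space of the restriction of `ν` to `E`. -/
abbrev L2Sum {ι : Type v} (ν : ι → Measure X) : Type (max u v) :=
  lp (fun i => Lp ℂ 2 (ν i)) 2

open Classical in
/-- The element of `⨁ᵢ L²(νᵢ)` whose coordinates are (the classes of) the functions `F i`; it is
set to `0` if the functions `F i` are not the coordinates of an element of this space. -/
def toL2Sum {ι : Type v} (ν : ι → Measure X) (F : ι → X → ℂ) : L2Sum ν :=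
  if h : ∃ g : L2Sum ν, ∀ i, (g i : X → ℂ) =ᵐ[ν i] F i then h.choose else 0

/-- The set `{ω : i < m ω}`.  Indices start at `0` here, so that this is the set `σ_{i+1}` of the
points where the multiplicity is at least `i + 1`. -/
def levelSet (m : X → ℕ) (i : ℕ) : Set X := {ω | i < m ω}

/-- `⨁ᵢ L²(σᵢ)` for the sets `σᵢ` of `m`. -/
abbrev LevelL2 (μ : Measure X) (m : X → ℕ) : Type u :=
  L2Sum (fun i : ℕ => μ.restrict (levelSet m i))

/-- The element `Cᵢ` of `⨁ⱼ L²(σⱼ)`: its `i`-th coordinate is the indicator of `σᵢ`, the other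
ones vanish. -/
def unitElement (μ : Measure X) (m : X → ℕ) (i : ℕ) : LevelL2 μ m :=
  toL2Sum _ (fun l => if l = i then (levelSet m i).indicator 1 else 0)

end DirectSum

/-- `S` is a pure isometry: a linear isometry such that the intersection of the ranges of its
powers is `0`. -/
def IsPureIsometry {E : Type u} [NormedAddCommGroup E] [InnerProductSpace ℂ E] (S : E → E) : Prop :=
  (∃ U : E →ₗᵢ[ℂ] E, ∀ f, U f = S f) ∧
    ∀ f : E, (∀ n : ℕ, f ∈ Set.range (S^[n])) → f = 0

/-! ### Generalized multiresolution analyses -/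

/-- `V` is a generalized multiresolution analysis in the separable Hilbert space `E`, relative to
the unitary representation `π` and the unitary operator `δ`. -/
structure IsGMRA {Γ : Type u} [CommGroup Γ] {E : Type v} [NormedAddCommGroup E]
    [InnerProductSpace ℂ E] [CompleteSpace E] (π : Γ →* (E ≃ₗᵢ[ℂ] E)) (δ : E ≃ₗᵢ[ℂ] E)
    (V : ℤ → Submodule ℂ E) : Prop where
  separable : TopologicalSpace.SeparableSpace E
  closed : ∀ j, IsClosed (V j : Set E)
  mono : ∀ j, V j ≤ V (j + 1)
  dilate : ∀ j, (V (j + 1) : Set E) = δ '' (V j : Set E)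
  inter : ∀ x, (∀ j, x ∈ V j) → x = 0
  dense : Dense (⋃ j, (V j : Set E))
  invariant : ∀ γ, ∀ x ∈ V 0, π γ x ∈ V 0

section Dual

variable {Γ : Type u} [CommGroup Γ] [TopologicalSpace Γ] [DiscreteTopology Γ]

/-- The dual endomorphism `α^*` of the dual group: `(α^* ω)(γ) = ω (α γ)`. -/
def dualEnd (α : Γ →* Γ) : PontryaginDual Γ →* PontryaginDual Γ :=
  (PontryaginDual.map (⟨α, continuous_of_discreteTopology⟩ : Γ →ₜ* Γ)).toMonoidHom

/-- The index `N` of `α(Γ)` in `Γ`. -/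
def dilIndex (α : Γ →* Γ) : ℕ := α.range.index

/-- `τ(ω) = c(α^*(ω)) ω⁻¹`. -/
def tau (α : Γ →* Γ) (c : PontryaginDual Γ → PontryaginDual Γ) (ω : PontryaginDual Γ) :
    PontryaginDual Γ :=
  c (dualEnd α ω) * ω⁻¹

/-- `∑_{α^*(ζ) = ω} m(ζ)`. -/
def fiberSum (α : Γ →* Γ) (m : PontryaginDual Γ → ℕ) (ω : PontryaginDual Γ) : ℕ :=
  ∑ᶠ ζ ∈ dualEnd α ⁻¹' {ω}, m ζ

/-- `m̃(ω) = ∑_{α^*(ζ) = ω} m(ζ) - m(ω)`; the subtraction does not truncate where the consistency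
inequality holds. -/
def mTilde (α : Γ →* Γ) (m : PontryaginDual Γ → ℕ) (ω : PontryaginDual Γ) : ℕ :=
  fiberSum α m ω - m ω

variable [MeasurableSpace (PontryaginDual Γ)]

/-- A multiplicity function: a Borel function with values in `{0, 1, 2, …}` that satisfies the
consistency inequality (almost everywhere). -/
structure IsMultiplicityFunction (μ : Measure (PontryaginDual Γ)) (α : Γ →* Γ)
    (m : PontryaginDual Γ → ℕ) : Prop where
  measurable : Measurable m
  le_fiberSum : ∀ᵐ ω ∂μ, m ω ≤ fiberSum α m ω

/-- `∑_{α^*(ζ) = ω} ∑_j a_j(ζ) conj (b_j(ζ))`, for two rows `a`, `b` of matrix functions. -/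
def rowProduct (α : Γ →* Γ) (a b : ℕ → PontryaginDual Γ → ℂ) (ω : PontryaginDual Γ) : ℂ :=
  ∑ᶠ ζ ∈ dualEnd α ⁻¹' {ω}, ∑' j, a j ζ * conj (b j ζ)

/-- `A = [a_{i,j}]` is a matrix of Borel functions with `a_{i,j}` supported in
`σ_j = levelSet m j`, and it satisfies the filter equation
`∑_{α^*(ζ) = ω} ∑_j a_{i,j}(ζ) conj (a_{i',j}(ζ)) = N δ_{i,i'} χ_{ρ_i}(ω)`,
where `ρ_i = levelSet r i`. -/
structure IsFilterMatrix (μ : Measure (PontryaginDual Γ)) (α : Γ →* Γ)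
    (m r : PontryaginDual Γ → ℕ) (A : ℕ → ℕ → PontryaginDual Γ → ℂ) : Prop where
  measurable : ∀ i j, Measurable (A i j)
  support : ∀ i j, ∀ᵐ ω ∂μ, ω ∉ levelSet m j → A i j ω = 0
  equation : ∀ i i', ∀ᵐ ω ∂μ, rowProduct α (A i) (A i') ω =
    if i = i' then (dilIndex α : ℂ) * (levelSet r i).indicator 1 ω else 0

/-- `H` is a filter relative to `m` and `α^*`. -/
def IsFilter (μ : Measure (PontryaginDual Γ)) (α : Γ →* Γ) (m : PontryaginDual Γ → ℕ)
    (H : ℕ → ℕ → PontryaginDual Γ → ℂ) : Prop :=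
  IsFilterMatrix μ α m m H

/-- `G` is a complementary filter to `H`. -/
structure IsComplementaryFilter (μ : Measure (PontryaginDual Γ)) (α : Γ →* Γ)
    (m : PontryaginDual Γ → ℕ) (H G : ℕ → ℕ → PontryaginDual Γ → ℂ) : Prop where
  filter : IsFilterMatrix μ α m (mTilde α m) G
  orthogonal : ∀ k i, ∀ᵐ ω ∂μ, rowProduct α (G k) (H i) ω = 0

/-- The Ruelle operator of the matrix function `A = [a_{i,j}]`, from `⨁ᵢ L²(νᵢ)` to
`⨁ⱼ L²(σⱼ)`: `[S_A f](ω) = Aᵗ(ω) f(α^*(ω))`, that is,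
`[S_A f]_j(ω) = ∑_i a_{i,j}(ω) f_i(α^*(ω))`. -/
def ruelle (μ : Measure (PontryaginDual Γ)) (α : Γ →* Γ) (m : PontryaginDual Γ → ℕ)
    {ι : Type v} {ν : ι → Measure (PontryaginDual Γ)}
    (A : ι → ℕ → PontryaginDual Γ → ℂ) (f : L2Sum ν) : LevelL2 μ m :=
  toL2Sum _ (fun j ω => ∑' i, A i j ω * f i (dualEnd α ω))

/-- Multiplication by the character `γ` of the dual group: `[π_γ f](ω) = ω(γ) f(ω)`. -/
def charMul {ι : Type v} {ν : ι → Measure (PontryaginDual Γ)} (γ : Γ) (f : L2Sum ν) : L2Sum ν :=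
  toL2Sum ν (fun i ω => (ω γ : ℂ) * f i ω)

/-- The measures `ν'_{i,ζ} = N α^*_*(ν_{i,ζ})`, for `ζ ∈ ker α^*`, where `ν_{i,ζ}` is the restriction
of `νᵢ` to `{ω : τ(ω) = ζ}`.  If `νᵢ` lives on `Eᵢ`, then `ν'_{i,ζ}` lives on
`E'_{i,ζ} = α^*({ω ∈ Eᵢ : τ(ω) = ζ})`. -/
def dilMeasure (α : Γ →* Γ) (c : PontryaginDual Γ → PontryaginDual Γ) {ι : Type v}
    (ν : ι → Measure (PontryaginDual Γ)) (p : ι × (dualEnd α).ker) :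
    Measure (PontryaginDual Γ) :=
  (dilIndex α : ℝ≥0∞) •
    ((ν p.1).restrict {ω | tau α c ω = (p.2 : PontryaginDual Γ)}).map (dualEnd α)

/-- The dilation `𝒟` of `𝒦 = ⨁ᵢ L²(νᵢ)` to `𝒦' = ⨁_{i,ζ} L²(ν'_{i,ζ})`:
`[𝒟 f]_{i,ζ}(ω) = N^{-1/2} f_i(ζ⁻¹ c(ω))`. -/
def dilation (α : Γ →* Γ) (c : PontryaginDual Γ → PontryaginDual Γ) {ι : Type v}
    (ν : ι → Measure (PontryaginDual Γ)) (f : L2Sum ν) : L2Sum (dilMeasure α c ν) :=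
  toL2Sum _ (fun p ω =>
    ((1 / Real.sqrt (dilIndex α) : ℝ) : ℂ) * f p.1 ((p.2 : PontryaginDual Γ)⁻¹ * c ω))

end Dual

/-! ### The canonical Hilbert space -/

section Canonical

/-- A family of measures on `X` together with its index type. -/
structure MeasureFamily (X : Type u) [MeasurableSpace X] where
  /-- the index type -/
  Idx : Type u
  /-- the measures -/
  meas : Idx → Measure X

variable {Γ : Type u} [CommGroup Γ] [TopologicalSpace Γ] [DiscreteTopology Γ]
  [MeasurableSpace (PontryaginDual Γ)]

/-- The measures of the spaces `𝒲₀ = ⨁ₖ L²(σ̃ₖ)` and `𝒲ₙ₊₁ = 𝒟(𝒲ₙ)`. -/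
def wFamily (μ : Measure (PontryaginDual Γ)) (α : Γ →* Γ) (c : PontryaginDual Γ → PontryaginDual Γ)
    (m : PontryaginDual Γ → ℕ) : ℕ → MeasureFamily (PontryaginDual Γ)
  | 0 => ⟨ULift.{u} ℕ, fun k => μ.restrict (levelSet (mTilde α m) k.down)⟩
  | n + 1 => ⟨(wFamily μ α c m n).Idx × (dualEnd α).ker, dilMeasure α c (wFamily μ α c m n).meas⟩

variable (μ : Measure (PontryaginDual Γ)) (α : Γ →* Γ) (c : PontryaginDual Γ → PontryaginDual Γ)
  (m : PontryaginDual Γ → ℕ)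

/-- The spaces `𝒲ₙ`. -/
abbrev WSpace (n : ℕ) : Type u := L2Sum (wFamily μ α c m n).meas

/-- The dilation `𝒟 : 𝒲ₙ → 𝒲ₙ₊₁`. -/
def wDilation (n : ℕ) (f : WSpace μ α c m n) : WSpace μ α c m (n + 1) :=
  dilation α c (wFamily μ α c m n).meas f

/-- The canonical Hilbert space `ℋ = 𝒱₀ ⊕ ⨁ₙ 𝒲ₙ`.  For `f` in it, `f.fst` is the component in
`𝒱₀ = ⨁ᵢ L²(σᵢ)` and `f.snd n` the one in `𝒲ₙ`. -/
abbrev HSpace : Type u :=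
  WithLp 2 (LevelL2 μ m × lp (fun n : ℕ => WSpace μ α c m n) 2)

/-- `𝒱₀` as a subspace of `ℋ`. -/
def coreSubspace : Submodule ℂ (HSpace μ α c m) where
  carrier := {f | f.snd = 0}
  zero_mem' := rfl
  add_mem' := by
    intro a b ha hb
    have ha' : a.snd = 0 := ha
    have hb' : b.snd = 0 := hb
    simp [ha', hb']
  smul_mem' := by
    intro t a ha
    have ha' : a.snd = 0 := ha
    simp [ha']

/-- The subspaces `𝒱ⱼ = T⁻ʲ(𝒱₀)` of `ℋ`. -/
def dilateCore (T : HSpace μ α c m ≃ₗᵢ[ℂ] HSpace μ α c m) (j : ℤ) :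
    Submodule ℂ (HSpace μ α c m) :=
  (coreSubspace μ α c m).map
    ((T ^ (-j)).toLinearEquiv : HSpace μ α c m →ₗ[ℂ] HSpace μ α c m)

end Canonical

/-! ### Multiplicity functions and filters of a GMRA -/

section Stone

variable {Γ : Type u} [CommGroup Γ] [TopologicalSpace Γ] [DiscreteTopology Γ]
  [MeasurableSpace (PontryaginDual Γ)] {E : Type v} [NormedAddCommGroup E] [InnerProductSpace ℂ E]

/-- The unitary map `J : V₀ → ⨁ᵢ L²(σᵢ)` turns the representation `π` on the invariant subspace
`V₀` into multiplication by characters: `[J(π_γ f)](ω) = ω(γ) [J f](ω)`. -/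
def IsStoneMap (μ : Measure (PontryaginDual Γ)) (m : PontryaginDual Γ → ℕ)
    (π : Γ →* (E ≃ₗᵢ[ℂ] E)) (V₀ : Submodule ℂ E) (J : V₀ ≃ₗᵢ[ℂ] LevelL2 μ m) : Prop :=
  ∀ (γ : Γ) (f : V₀), ∃ g : V₀, (g : E) = π γ f ∧
    ∀ i, (J g i : PontryaginDual Γ → ℂ) =ᵐ[μ.restrict (levelSet m i)] fun ω => (ω γ : ℂ) * J f i ω

/-- `m` is the multiplicity function associated, with respect to Haar measure `μ`, to the
representation `π` on the core subspace `V 0`. -/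
def HasMultiplicityFunction (μ : Measure (PontryaginDual Γ)) (π : Γ →* (E ≃ₗᵢ[ℂ] E))
    (V : ℤ → Submodule ℂ E) (m : PontryaginDual Γ → ℕ) : Prop :=
  Measurable m ∧ ∃ J : V 0 ≃ₗᵢ[ℂ] LevelL2 μ m, IsStoneMap μ m π (V 0) J

/-- `H = [h_{i,j}]` is a filter constructed from the GMRA `V` relative to `π` and `δ`, with
multiplicity function `m`: for some `J` as above, `⨁ⱼ h_{i,j}` is `J(δ⁻¹(J⁻¹(Cᵢ)))` for all `i`. -/
def IsFilterConstructedFrom (μ : Measure (PontryaginDual Γ)) (π : Γ →* (E ≃ₗᵢ[ℂ] E))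
    (δ : E ≃ₗᵢ[ℂ] E) (V : ℤ → Submodule ℂ E) (m : PontryaginDual Γ → ℕ)
    (H : ℕ → ℕ → PontryaginDual Γ → ℂ) : Prop :=
  ∃ J : V 0 ≃ₗᵢ[ℂ] LevelL2 μ m, IsStoneMap μ m π (V 0) J ∧
    ∀ i, ∃ g : V 0, (g : E) = δ.symm (J.symm (unitElement μ m i) : E) ∧
      ∀ j, (J g j : PontryaginDual Γ → ℂ) =ᵐ[μ.restrict (levelSet m j)] H i j

end Stone

end GMRA

end

open GMRA

/-!
The operator `T` acts on `ℋ = 𝒱₀ ⊕ ⨁ₙ 𝒲ₙ` as a shift: it carries `𝒲ₙ₊₁` onto `𝒲ₙ` by `𝒟⁻¹`,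
carries `𝒱₀ ⊕ 𝒲₀` to `𝒱₀` by `S_H + S_G`, and restricts to `S_H` on `𝒱₀`. It is unitary as soon as
each `𝒟` and `S_H + S_G` are (`exists_shift_equiv`).

The dilation is unitary since `ω = τ(ω)⁻¹ c(α^* ω)`, so that `α^*` is injective on each piece
`{τ = ζ}`, where the weight `N^{-1/2}` makes up for the factor `N` in the measures
(`isL2Isometry_dilation`); its inverse takes `K` to the family of the functions
`√N K_{i,τ(ω)}(α^* ω)` (`exists_dilation_eq`).

That `S_H + S_G` is unitary is linear algebra on the fibres of `α^*`. The kernel of `α^*` is the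
dual of `Γ / α(Γ)` and has `N` elements, the fibre over `ω` consists of the points `k c(ω)` with
`k` in the kernel, and `N μ` is the integral over `μ` of the counting measures of the fibres
(`sum_map_mul_section`). Over almost every `ω` the matrix composed of `H` and `G` is a finite
matrix with one row for each `i ≤ m(ω)` and each `k ≤ m̃(ω)` and one column for each pair of a
point `ζ` of the fibre and a `j ≤ m(ζ)`. The filter equations say that its rows are orthogonal
with square norm `N`, which gives the isometry property (`IsFilterFibre.sum_enorm_sq`). By the
definition of `m̃` and the consistency inequality the matrix is square, hence its columns are
orthogonal as well, which gives surjectivity (`IsFilterFibre.tsum_mul_sum_conj`).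

All operators are treated as maps of families of Borel functions that preserve the (possibly
infinite) sum of the square integrals; `IsL2Isometry` turns such a map into an isometry of the
Hilbert spaces, and a measurable preimage of a square integrable family is automatically square
integrable.

For the multiresolution analysis (`isGMRA_dilateCore`): `T(𝒱₀) ⊆ 𝒱₀` gives the nesting, `T ^ n`
maps `𝒱₀ ⊕ 𝒲₀ ⊕ ⋯ ⊕ 𝒲ₙ₋₁` to `𝒱₀`, which gives density, and a vector in all `𝒱ⱼ` lies in the range
of every power of `S_H`, so that it vanishes because `S_H` is pure.
-/

noncomputable section

namespace GMRA

universe u v w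

/-! ### The dual group and the fibres of the dual endomorphism -/

section DualGroup

variable {Γ : Type u} [CommGroup Γ] [TopologicalSpace Γ] [DiscreteTopology Γ]

/-- The dual group embeds into a countable power of the circle. -/
instance secondCountableTopology_pontryaginDual [Countable Γ] :
    SecondCountableTopology (PontryaginDual Γ) :=
  (ContinuousMonoidHom.isClosedEmbedding_coe
    (A := Γ) (B := Circle)).isEmbedding.secondCountableTopology

@[simp]
theorem dualEnd_apply (α : Γ →* Γ) (ω : PontryaginDual Γ) (γ : Γ) :
    dualEnd α ω γ = ω (α γ) := rfl

theorem continuous_dualEnd (α : Γ →* Γ) : Continuous (dualEnd α) :=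
  (PontryaginDual.map (⟨α, continuous_of_discreteTopology⟩ : Γ →ₜ* Γ)).continuous_toFun

/-- The character of `Γ` obtained from a character of `Γ ⧸ α(Γ)`. -/
def quotientCharacter (α : Γ →* Γ) (φ : Γ ⧸ α.range →* Circleˣ) : PontryaginDual Γ :=
  (⟨((toUnits (G := Circle)).symm.toMonoidHom.comp φ).comp (QuotientGroup.mk' α.range),
    continuous_of_discreteTopology⟩ : Γ →ₜ* Circle)

/-- The kernel of `α^*` consists of the characters that are trivial on `α(Γ)`. -/
def kerDualEndEquiv (α : Γ →* Γ) : (dualEnd α).ker ≃ (Γ ⧸ α.range →* Circleˣ) where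
  toFun k := QuotientGroup.lift α.range
    ((toUnits (G := Circle)).toMonoidHom.comp
      (MonoidHomClass.toMonoidHom (k : PontryaginDual Γ))) (by
      rintro _ ⟨γ, rfl⟩
      have h := DFunLike.congr_fun (MonoidHom.mem_ker.1 k.2) γ
      rw [dualEnd_apply, PontryaginDual.one_apply] at h
      exact Units.ext h)
  invFun φ := ⟨quotientCharacter α φ, MonoidHom.mem_ker.2 <| PontryaginDual.ext fun γ => by
    have h : ((α γ : Γ) : Γ ⧸ α.range) = 1 := (QuotientGroup.eq_one_iff _).2 ⟨γ, rfl⟩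
    change (toUnits (G := Circle)).symm (φ ((α γ : Γ) : Γ ⧸ α.range)) = 1
    rw [h, map_one, map_one]⟩
  left_inv k := Subtype.ext (PontryaginDual.ext fun γ => rfl)
  right_inv φ := by
    refine MonoidHom.ext fun x => ?_
    induction x using QuotientGroup.induction_on with
    | H γ => exact Units.ext rfl

/-- The kernel of `α^*` is the dual of the finite group `Γ ⧸ α(Γ)`, which has `N` characters. -/
theorem card_ker_dualEnd (α : Γ →* Γ) (hα : 1 < α.range.index) :
    Nat.card (dualEnd α).ker = dilIndex α := by
  have : α.range.FiniteIndex := ⟨by omega⟩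
  have : NeZero (Monoid.exponent (Γ ⧸ α.range)) := ⟨Monoid.exponent_ne_zero_of_finite⟩
  rw [Nat.card_congr (kerDualEndEquiv α), CommGroup.card_monoidHom_of_hasEnoughRootsOfUnity]
  rfl

theorem finite_ker_dualEnd (α : Γ →* Γ) (hα : 1 < α.range.index) :
    Finite (dualEnd α).ker :=
  Nat.finite_of_card_ne_zero (by rw [card_ker_dualEnd α hα, dilIndex]; omega)

variable {α : Γ →* Γ} {c : PontryaginDual Γ → PontryaginDual Γ}

theorem dualEnd_mul_section (hc : ∀ ω, dualEnd α (c ω) = ω) (k : (dualEnd α).ker)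
    (ω : PontryaginDual Γ) : dualEnd α (k * c ω) = ω := by
  rw [map_mul, MonoidHom.mem_ker.1 k.2, one_mul, hc]

theorem tau_mem_ker (hc : ∀ ω, dualEnd α (c ω) = ω) (ω : PontryaginDual Γ) :
    tau α c ω ∈ (dualEnd α).ker := by
  rw [MonoidHom.mem_ker, tau, map_mul, hc, map_inv, mul_inv_cancel]

theorem tau_inv_mul_section (ω : PontryaginDual Γ) :
    (tau α c ω)⁻¹ * c (dualEnd α ω) = ω := by
  simp [tau]

theorem tau_mul_section (hc : ∀ ω, dualEnd α (c ω) = ω) (k : (dualEnd α).ker)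
    (ω : PontryaginDual Γ) : tau α c ((k : PontryaginDual Γ)⁻¹ * c ω) = k := by
  have h := dualEnd_mul_section hc k⁻¹ ω
  rw [Subgroup.coe_inv] at h
  rw [tau, h, mul_inv, inv_inv, mul_comm (k : PontryaginDual Γ), mul_inv_cancel_left]

/-- The fibre of `α^*` over `ω` is parametrized by `k ↦ k c(ω)`, for `k ∈ ker α^*`. -/
theorem range_mul_section (hc : ∀ ω, dualEnd α (c ω) = ω) (ω : PontryaginDual Γ) :
    Set.range (fun k : (dualEnd α).ker => (k : PontryaginDual Γ) * c ω) =
      dualEnd α ⁻¹' {ω} := by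
  ext ζ
  constructor
  · rintro ⟨k, rfl⟩
    exact dualEnd_mul_section hc k ω
  · rintro rfl
    exact ⟨⟨_, inv_mem (tau_mem_ker hc ζ)⟩, tau_inv_mul_section ζ⟩

theorem finsum_fibre [Fintype (dualEnd α).ker] {M : Type*} [AddCommMonoid M]
    (hc : ∀ ω, dualEnd α (c ω) = ω) (F : PontryaginDual Γ → M) (ω : PontryaginDual Γ) :
    ∑ᶠ ζ ∈ dualEnd α ⁻¹' {ω}, F ζ = ∑ k : (dualEnd α).ker, F (k * c ω) := by
  rw [← range_mul_section hc ω, finsum_mem_range, finsum_eq_sum_of_fintype]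
  intro k l h
  exact Subtype.ext (mul_right_cancel h)

end DualGroup

section FibreMeasure

variable {Γ : Type u} [CommGroup Γ] [TopologicalSpace Γ] [DiscreteTopology Γ]
  [MeasurableSpace (PontryaginDual Γ)] [BorelSpace (PontryaginDual Γ)]
  {μ : Measure (PontryaginDual Γ)} [μ.IsHaarMeasure]
  {α : Γ →* Γ} {c : PontryaginDual Γ → PontryaginDual Γ}

theorem measurable_mul_section (hcm : Measurable c) (k : (dualEnd α).ker) :
    Measurable fun ω => (k : PontryaginDual Γ) * c ω :=
  hcm.const_mul _

theorem measurePreserving_dualEnd (hc : ∀ ω, dualEnd α (c ω) = ω) :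
    MeasurePreserving (dualEnd α) μ μ :=
  MonoidHom.measurePreserving (continuous_dualEnd α) (fun ω => ⟨c ω, hc ω⟩) rfl

/-- Disintegration of Haar measure along `α^*`: `N μ` is the sum over the fibres of `α^*`. -/
theorem sum_map_mul_section [Fintype (dualEnd α).ker] (hα : 1 < α.range.index)
    (hcm : Measurable c) (hc : ∀ ω, dualEnd α (c ω) = ω) :
    Measure.sum (fun k : (dualEnd α).ker => μ.map fun ω => (k : PontryaginDual Γ) * c ω) =
      (dilIndex α : ℝ≥0∞) • μ := by
  refine Measure.ext_of_lintegral _ fun f hf => ?_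
  have hmk : ∀ k : (dualEnd α).ker, Measurable fun ω => f ((k : PontryaginDual Γ) * c ω) :=
    fun k => hf.comp (measurable_mul_section hcm k)
  rw [lintegral_sum_measure, tsum_fintype, lintegral_smul_measure]
  have h1 : ∀ k : (dualEnd α).ker,
      ∫⁻ ζ, f ζ ∂(μ.map fun ω => (k : PontryaginDual Γ) * c ω) =
        ∫⁻ ω, f (k * c (dualEnd α ω)) ∂μ := by
    intro k
    rw [lintegral_map hf (measurable_mul_section hcm k),
      ← (measurePreserving_dualEnd (μ := μ) hc).lintegral_comp (hmk k)]
  -- both sums run over the coset `ω ker α^*`, as `c(α^* ω) = τ(ω) ω`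
  have h2 : ∀ ω, ∑ k : (dualEnd α).ker, f (k * c (dualEnd α ω)) =
      ∑ k : (dualEnd α).ker, f (k * ω) := by
    intro ω
    refine Fintype.sum_equiv (Equiv.mulRight ⟨tau α c ω, tau_mem_ker hc ω⟩) _ _ fun k => ?_
    simp [tau, mul_assoc]
  simp_rw [h1]
  rw [← lintegral_finsetSum]
  · simp_rw [h2]
    rw [lintegral_finsetSum]
    · simp_rw [lintegral_mul_left_eq_self]
      rw [Finset.sum_const, Finset.card_univ, ← Nat.card_eq_fintype_card, card_ker_dualEnd α hα,
        nsmul_eq_mul, smul_eq_mul]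
    · exact fun k _ => hf.comp (measurable_const_mul _)
  · exact fun k _ => (hmk k).comp (continuous_dualEnd α).measurable

theorem quasiMeasurePreserving_mul_section (hα : 1 < α.range.index)
    (hcm : Measurable c) (hc : ∀ ω, dualEnd α (c ω) = ω) (k : (dualEnd α).ker) :
    Measure.QuasiMeasurePreserving (fun ω => (k : PontryaginDual Γ) * c ω) μ μ := by
  have := finite_ker_dualEnd α hα
  have := Fintype.ofFinite (dualEnd α).ker
  refine ⟨measurable_mul_section hcm k, ?_⟩
  refine (Measure.absolutelyContinuous_of_le (Measure.le_sum
    (fun k : (dualEnd α).ker => μ.map fun ω => (k : PontryaginDual Γ) * c ω) k)).trans ?_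
  rw [sum_map_mul_section hα hcm hc]
  exact Measure.smul_absolutelyContinuous

/-- A property that holds almost everywhere holds on almost every fibre of `α^*`. -/
theorem ae_forall_fibre (hα : 1 < α.range.index) (hcm : Measurable c)
    (hc : ∀ ω, dualEnd α (c ω) = ω) {P : PontryaginDual Γ → Prop} (hP : ∀ᵐ ζ ∂μ, P ζ) :
    ∀ᵐ ω ∂μ, ∀ k : (dualEnd α).ker, P (k * c ω) := by
  have := finite_ker_dualEnd α hα
  exact ae_all_iff.2 fun k => (quasiMeasurePreserving_mul_section hα hcm hc k).ae hP

/-- A property that holds on almost every fibre of `α^*` holds almost everywhere. -/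
theorem ae_of_ae_forall_fibre (hc : ∀ ω, dualEnd α (c ω) = ω) {P : PontryaginDual Γ → Prop}
    (hP : ∀ᵐ ω ∂μ, ∀ k : (dualEnd α).ker, P (k * c ω)) : ∀ᵐ ζ ∂μ, P ζ := by
  filter_upwards [(measurePreserving_dualEnd (μ := μ) hc).quasiMeasurePreserving.ae hP] with ζ h
  have := h ⟨_, inv_mem (tau_mem_ker hc ζ)⟩
  rwa [tau_inv_mul_section] at this

/-- The integral of the sums over the fibres of `α^*` is `N` times the integral. -/
theorem lintegral_sum_fibre [Fintype (dualEnd α).ker] (hα : 1 < α.range.index)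
    (hcm : Measurable c) (hc : ∀ ω, dualEnd α (c ω) = ω) {f : PontryaginDual Γ → ℝ≥0∞}
    (hf : AEMeasurable f μ) :
    ∫⁻ ω, ∑ k : (dualEnd α).ker, f (k * c ω) ∂μ = dilIndex α * ∫⁻ ζ, f ζ ∂μ := by
  have hq := fun k => quasiMeasurePreserving_mul_section (μ := μ) hα hcm hc k
  have hfk : ∀ k : (dualEnd α).ker, AEMeasurable (fun ω => f (k * c ω)) μ :=
    fun k => hf.comp_quasiMeasurePreserving (hq k)
  rw [lintegral_finsetSum' _ fun k _ => hfk k,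
    ← smul_eq_mul, ← lintegral_smul_measure, ← sum_map_mul_section hα hcm hc,
    lintegral_sum_measure, tsum_fintype]
  refine Finset.sum_congr rfl fun k _ => ?_
  rw [lintegral_map' (hf.mono_ac (hq k).absolutelyContinuous) (hq k).measurable.aemeasurable]

theorem measurable_tau [Countable Γ] (hcm : Measurable c) : Measurable (tau α c) :=
  (hcm.comp (continuous_dualEnd α).measurable).mul measurable_inv

end FibreMeasure

/-! ### Operators on direct sums of `L²` spaces given by their action on functions -/

section HilbertSum

variable {ι : Type*} {E : ι → Type*} [∀ i, NormedAddCommGroup (E i)]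

theorem hasSum_norm_sq (f : lp E 2) : HasSum (fun i => ‖f i‖ ^ 2) (‖f‖ ^ 2) := by
  simpa [Real.rpow_ofNat] using lp.hasSum_norm (p := 2) (by norm_num) f

theorem memℓp_two_of_summable {f : ∀ i, E i} (h : Summable fun i => ‖f i‖ ^ 2) : Memℓp f 2 :=
  memℓp_gen (by simpa [Real.rpow_ofNat] using h)

end HilbertSum

section Energy

variable {X : Type u} [MeasurableSpace X] {ι : Type v} {κ : Type w}

/-- The square of the norm of the family of measurable functions `F` in `⨁ᵢ L²(νᵢ)`; it is `∞` if
the family does not belong to this space. -/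
def energy (ν : ι → Measure X) (F : ι → X → ℂ) : ℝ≥0∞ :=
  ∑' i, ∫⁻ x, ‖F i x‖ₑ ^ 2 ∂ν i

variable {ν : ι → Measure X} {ν' : κ → Measure X}

theorem enorm_sq_eq_lintegral {ρ : Measure X} (f : Lp ℂ 2 ρ) :
    ‖f‖ₑ ^ 2 = ∫⁻ x, ‖f x‖ₑ ^ 2 ∂ρ := by
  rw [Lp.enorm_def, eLpNorm_eq_lintegral_rpow_enorm_toReal (by norm_num) (by norm_num),
    ← ENNReal.rpow_natCast, ← ENNReal.rpow_mul]
  simp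

theorem enorm_sq_eq_energy (f : L2Sum ν) : ‖f‖ₑ ^ 2 = energy ν fun i => f i := by
  have h := hasSum_norm_sq f
  have hn : ∀ {V : Type (max u v)} [NormedAddCommGroup V] (x : V),
      ‖x‖ₑ ^ 2 = ENNReal.ofReal (‖x‖ ^ 2) := fun x => by
    rw [ENNReal.ofReal_pow (norm_nonneg _), ofReal_norm]
  have hn' : ∀ {V : Type u} [NormedAddCommGroup V] (x : V),
      ‖x‖ₑ ^ 2 = ENNReal.ofReal (‖x‖ ^ 2) := fun x => by
    rw [ENNReal.ofReal_pow (norm_nonneg _), ofReal_norm]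
  rw [hn, ← h.tsum_eq, ENNReal.ofReal_tsum_of_nonneg (fun _ => by positivity) h.summable, energy]
  exact tsum_congr fun i => by rw [← hn', enorm_sq_eq_lintegral]

theorem energy_coe_lt_top (f : L2Sum ν) : energy ν (fun i => f i) < ∞ := by
  rw [← enorm_sq_eq_energy]
  exact ENNReal.pow_lt_top enorm_lt_top

theorem energy_congr {F K : ι → X → ℂ} (h : ∀ i, F i =ᵐ[ν i] K i) : energy ν F = energy ν K :=
  tsum_congr fun i => lintegral_congr_ae ((h i).mono fun x hx => by simp only [hx])

theorem energy_eq_zero_iff {F : ι → X → ℂ} (hF : ∀ i, AEMeasurable (F i) (ν i)) :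
    energy ν F = 0 ↔ ∀ i, F i =ᵐ[ν i] 0 := by
  rw [energy, ENNReal.tsum_eq_zero]
  refine forall_congr' fun i => ?_
  rw [lintegral_eq_zero_iff' ((hF i).enorm.pow_const 2)]
  exact ⟨fun h => h.mono fun x hx => by simpa using hx, fun h => h.mono fun x hx => by simp [hx]⟩

theorem L2Sum.ext_ae {f g : L2Sum ν} (h : ∀ i, f i =ᵐ[ν i] g i) : f = g :=
  lp.ext (funext fun i => Lp.ext (h i))

theorem L2Sum.measurable_coe (f : L2Sum ν) (i : ι) : Measurable (f i) :=
  (Lp.stronglyMeasurable (f i)).measurable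

theorem L2Sum.coe_add (f g : L2Sum ν) (i : ι) :
    (f + g : L2Sum ν) i =ᵐ[ν i] fun x => f i x + g i x := by
  rw [lp.coeFn_add]
  exact Lp.coeFn_add (f i) (g i)

theorem L2Sum.coe_smul (a : ℂ) (f : L2Sum ν) (i : ι) :
    (a • f : L2Sum ν) i =ᵐ[ν i] fun x => a * f i x := by
  rw [lp.coeFn_smul]
  exact Lp.coeFn_smul a (f i)

/-- A family of functions with finite energy belongs to `⨁ᵢ L²(νᵢ)`. -/
theorem exists_coe_eq {F : ι → X → ℂ} (hF : ∀ i, AEMeasurable (F i) (ν i))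
    (h : energy ν F < ∞) : ∃ g : L2Sum ν, ∀ i, g i =ᵐ[ν i] F i := by
  have hi : ∀ i, MemLp (F i) 2 (ν i) := fun i => by
    refine ⟨(hF i).aestronglyMeasurable, ?_⟩
    rw [eLpNorm_lt_top_iff_lintegral_rpow_enorm_lt_top (by norm_num) (by norm_num)]
    simpa using (ENNReal.le_tsum i).trans_lt h
  have hsum : ∑' i, ENNReal.ofReal (‖(hi i).toLp‖ ^ 2) ≠ ∞ := by
    refine ne_of_eq_of_ne (tsum_congr fun i => ?_) h.ne
    rw [ENNReal.ofReal_pow (norm_nonneg _), ofReal_norm, enorm_sq_eq_lintegral]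
    exact lintegral_congr_ae ((hi i).coeFn_toLp.mono fun x hx => by simp only [hx])
  have hs : Summable fun i => ‖(hi i).toLp‖ ^ 2 := by
    refine (ENNReal.summable_toReal hsum).congr fun i => ?_
    rw [ENNReal.toReal_ofReal (by positivity)]
  exact ⟨⟨fun i => (hi i).toLp, memℓp_two_of_summable hs⟩, fun i => (hi i).coeFn_toLp⟩

theorem toL2Sum_coe {F : ι → X → ℂ} (h : ∃ g : L2Sum ν, ∀ i, g i =ᵐ[ν i] F i) (i : ι) :
    toL2Sum ν F i =ᵐ[ν i] F i := by
  rw [toL2Sum, dif_pos h]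
  exact h.choose_spec i

/-- A map `Φ` between families of functions that is almost everywhere linear and preserves the
norms of `⨁ᵢ L²(νᵢ)` and `⨁ₖ L²(ν'ₖ)`. -/
structure IsL2Isometry (ν : ι → Measure X) (ν' : κ → Measure X)
    (Φ : (ι → X → ℂ) → κ → X → ℂ) : Prop where
  measurable : ∀ F, (∀ i, Measurable (F i)) → ∀ k, Measurable (Φ F k)
  map_add : ∀ F K, (∀ i, Measurable (F i)) → (∀ i, Measurable (K i)) →
    ∀ k, Φ (fun i x => F i x + K i x) k =ᵐ[ν' k] fun x => Φ F k x + Φ K k x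
  map_smul : ∀ (a : ℂ) F, (∀ i, Measurable (F i)) →
    ∀ k, Φ (fun i x => a * F i x) k =ᵐ[ν' k] fun x => a * Φ F k x
  energy_eq : ∀ F, (∀ i, Measurable (F i)) → energy ν' (Φ F) = energy ν F

namespace IsL2Isometry

variable {Φ : (ι → X → ℂ) → κ → X → ℂ}

/-- As `Φ` preserves norms, it is compatible with equality almost everywhere. -/
theorem congr_ae (hΦ : IsL2Isometry ν ν' Φ) {F K : ι → X → ℂ} (hF : ∀ i, Measurable (F i))
    (hK : ∀ i, Measurable (K i)) (h : ∀ i, F i =ᵐ[ν i] K i) (k : κ) : Φ F k =ᵐ[ν' k] Φ K k := by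
  have hd : ∀ i, Measurable fun x => F i x - K i x := fun i => (hF i).sub (hK i)
  have h0 : energy ν' (Φ fun i x => F i x - K i x) = 0 := by
    rw [hΦ.energy_eq _ hd, energy_eq_zero_iff fun i => (hd i).aemeasurable]
    exact fun i => (h i).mono fun x hx => by simp [hx]
  rw [energy_eq_zero_iff fun k => (hΦ.measurable _ hd k).aemeasurable] at h0
  have hadd := hΦ.map_add _ K hd hK k
  simp only [sub_add_cancel] at hadd
  filter_upwards [hadd, h0 k] with x hx h0x
  rw [hx, h0x, Pi.zero_apply, zero_add]

/-- The family `Φ f` belongs to `⨁ₖ L²(ν'ₖ)`, so that `toL2Sum` takes its intended value. -/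
theorem coe_toL2Sum (hΦ : IsL2Isometry ν ν' Φ) (f : L2Sum ν) (k : κ) :
    toL2Sum ν' (Φ fun i => f i) k =ᵐ[ν' k] Φ (fun i => f i) k := by
  refine toL2Sum_coe (exists_coe_eq
    (fun k => (hΦ.measurable _ f.measurable_coe k).aemeasurable) ?_) k
  rw [hΦ.energy_eq _ f.measurable_coe]
  exact energy_coe_lt_top f

/-- The functions representing `f` may be replaced by almost everywhere equal ones. -/
theorem coe_toL2Sum_of_ae (hΦ : IsL2Isometry ν ν' Φ) {f : L2Sum ν} {F : ι → X → ℂ}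
    (hF : ∀ i, Measurable (F i)) (h : ∀ i, f i =ᵐ[ν i] F i) (k : κ) :
    toL2Sum ν' (Φ fun i => f i) k =ᵐ[ν' k] Φ F k :=
  (hΦ.coe_toL2Sum f k).trans (hΦ.congr_ae f.measurable_coe hF h k)

/-- The linear isometry between the Hilbert spaces that `Φ` induces. -/
def toLinearIsometry (hΦ : IsL2Isometry ν ν' Φ) : L2Sum ν →ₗᵢ[ℂ] L2Sum ν' where
  toFun f := toL2Sum ν' (Φ fun i => f i)
  map_add' f g := L2Sum.ext_ae fun k => by
    have hm : ∀ i, Measurable fun x => f i x + g i x :=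
      fun i => (f.measurable_coe i).add (g.measurable_coe i)
    filter_upwards [hΦ.coe_toL2Sum_of_ae hm (L2Sum.coe_add f g) k,
      hΦ.map_add _ _ f.measurable_coe g.measurable_coe k, hΦ.coe_toL2Sum f k,
      hΦ.coe_toL2Sum g k, L2Sum.coe_add (toL2Sum ν' (Φ fun i => f i))
        (toL2Sum ν' (Φ fun i => g i)) k] with x h1 h2 h3 h4 h5
    rw [h1, h2, h5, h3, h4]
  map_smul' a f := L2Sum.ext_ae fun k => by
    have hm : ∀ i, Measurable fun x => a * f i x := fun i => (f.measurable_coe i).const_mul a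
    filter_upwards [hΦ.coe_toL2Sum_of_ae hm (L2Sum.coe_smul a f) k,
      hΦ.map_smul a _ f.measurable_coe k, hΦ.coe_toL2Sum f k,
      L2Sum.coe_smul a (toL2Sum ν' (Φ fun i => f i)) k] with x h1 h2 h3 h4
    rw [h1, h2, RingHom.id_apply, h4, h3]
  norm_map' f := by
    have h : ‖toL2Sum ν' (Φ fun i => f i)‖ₑ ^ 2 = ‖f‖ₑ ^ 2 := by
      rw [enorm_sq_eq_energy, enorm_sq_eq_energy, energy_congr (hΦ.coe_toL2Sum f),
        hΦ.energy_eq _ f.measurable_coe]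
    have h' := (ENNReal.pow_right_strictMono two_ne_zero).injective h
    exact congrArg ENNReal.toReal h'

/-- A preimage among the measurable families is automatically square integrable. -/
theorem toLinearIsometry_surjective (hΦ : IsL2Isometry ν ν' Φ)
    (hs : ∀ K : κ → X → ℂ, (∀ k, Measurable (K k)) →
      ∃ F : ι → X → ℂ, (∀ i, Measurable (F i)) ∧ ∀ k, Φ F k =ᵐ[ν' k] K k) :
    Function.Surjective hΦ.toLinearIsometry := by
  intro g
  obtain ⟨F, hF, hFg⟩ := hs (fun k => g k) g.measurable_coe
  obtain ⟨f, hf⟩ := exists_coe_eq (ν := ν) (fun i => (hF i).aemeasurable) (by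
    rw [← hΦ.energy_eq F hF, energy_congr hFg]
    exact energy_coe_lt_top g)
  exact ⟨f, L2Sum.ext_ae fun k => (hΦ.coe_toL2Sum_of_ae hF hf k).trans (hFg k)⟩

/-- The unitary operator that `Φ` induces if it is onto. -/
def toEquiv (hΦ : IsL2Isometry ν ν' Φ)
    (hs : ∀ K : κ → X → ℂ, (∀ k, Measurable (K k)) →
      ∃ F : ι → X → ℂ, (∀ i, Measurable (F i)) ∧ ∀ k, Φ F k =ᵐ[ν' k] K k) :
    L2Sum ν ≃ₗᵢ[ℂ] L2Sum ν' :=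
  LinearIsometryEquiv.ofSurjective hΦ.toLinearIsometry (hΦ.toLinearIsometry_surjective hs)

end IsL2Isometry

end Energy

/-! ### Multiplication by characters and dilation -/

section CharMul

theorem measurable_eval {Γ : Type u} [CommGroup Γ] [TopologicalSpace Γ]
    [MeasurableSpace (PontryaginDual Γ)] [BorelSpace (PontryaginDual Γ)] (γ : Γ) :
    Measurable fun ω : PontryaginDual Γ => (ω γ : ℂ) := by
  have h : Continuous fun ω : PontryaginDual Γ => ω γ :=
    ContinuousEvalConst.continuous_eval_const (F := Γ →ₜ* Circle) γ
  exact (Continuous.comp (by fun_prop : Continuous fun z : Circle => (z : ℂ)) h).measurable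

variable {Γ : Type u} [CommGroup Γ] [TopologicalSpace Γ]
  [MeasurableSpace (PontryaginDual Γ)] [BorelSpace (PontryaginDual Γ)]
  {ι : Type v} {ν : ι → Measure (PontryaginDual Γ)}

theorem isL2Isometry_charMul (ν : ι → Measure (PontryaginDual Γ)) (γ : Γ) :
    IsL2Isometry ν ν fun F i ω => (ω γ : ℂ) * F i ω where
  measurable F hF i := (measurable_eval γ).mul (hF i)
  map_add F K _ _ i := .of_forall fun x => mul_add _ _ _
  map_smul a F _ i := .of_forall fun x => mul_left_comm _ _ _
  energy_eq F _ := tsum_congr fun i => lintegral_congr fun x => by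
    rw [enorm_mul, ← ofReal_norm (x γ : ℂ), Circle.norm_coe, ENNReal.ofReal_one, one_mul]

theorem coe_charMul (γ : Γ) (f : L2Sum ν) (i : ι) :
    charMul γ f i =ᵐ[ν i] fun ω => (ω γ : ℂ) * f i ω :=
  (isL2Isometry_charMul ν γ).coe_toL2Sum f i

theorem charMul_mul (γ γ' : Γ) (f : L2Sum ν) :
    charMul (γ * γ') f = charMul γ (charMul γ' f) := by
  refine L2Sum.ext_ae fun i => ?_
  filter_upwards [coe_charMul (γ * γ') f i, coe_charMul γ (charMul γ' f) i,
    coe_charMul γ' f i] with ω h1 h2 h3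
  rw [h1, h2, h3, map_mul, Circle.coe_mul, mul_assoc]

theorem charMul_one (f : L2Sum ν) : charMul (1 : Γ) f = f := by
  refine L2Sum.ext_ae fun i => ?_
  filter_upwards [coe_charMul 1 f i] with ω h1
  rw [h1, map_one, Circle.coe_one, one_mul]

/-- Multiplication by a character as a unitary operator. -/
def charMulEquiv (ν : ι → Measure (PontryaginDual Γ)) (γ : Γ) : L2Sum ν ≃ₗᵢ[ℂ] L2Sum ν :=
  LinearIsometryEquiv.ofSurjective (isL2Isometry_charMul ν γ).toLinearIsometry fun f =>
    ⟨charMul γ⁻¹ f, (charMul_mul γ γ⁻¹ f).symm.trans (by rw [mul_inv_cancel, charMul_one])⟩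

end CharMul

section Dilation

variable {Γ : Type u} [CommGroup Γ] [TopologicalSpace Γ] [DiscreteTopology Γ] [Countable Γ]
  [MeasurableSpace (PontryaginDual Γ)] [BorelSpace (PontryaginDual Γ)]
  {α : Γ →* Γ} {c : PontryaginDual Γ → PontryaginDual Γ} {ι : Type v}

theorem measurableSet_tau_eq (hcm : Measurable c) (k : PontryaginDual Γ) :
    MeasurableSet {ω | tau α c ω = k} :=
  measurable_tau hcm (measurableSet_singleton k)

/-- The restrictions of a measure to the pieces `{τ = ζ}` add up to the measure. -/
theorem sum_restrict_tau (hα : 1 < α.range.index) (hcm : Measurable c)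
    (hc : ∀ ω, dualEnd α (c ω) = ω) (ρ : Measure (PontryaginDual Γ)) :
    Measure.sum (fun k : (dualEnd α).ker => ρ.restrict {ω | tau α c ω = k}) = ρ := by
  have := finite_ker_dualEnd α hα
  have hU : ⋃ k : (dualEnd α).ker, {ω | tau α c ω = (k : PontryaginDual Γ)} = Set.univ :=
    Set.eq_univ_of_forall fun ω => Set.mem_iUnion.2 ⟨⟨_, tau_mem_ker hc ω⟩, rfl⟩
  rw [← Measure.restrict_iUnion _ fun k => measurableSet_tau_eq hcm _, hU, Measure.restrict_univ]
  intro k l hkl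
  refine Set.disjoint_left.2 fun ω hk hl => hkl (Subtype.ext ?_)
  exact (show tau α c ω = k from hk).symm.trans hl

theorem enorm_sqrt_inv_sq {N : ℕ} (hN : N ≠ 0) :
    (N : ℝ≥0∞) * ‖((1 / Real.sqrt N : ℝ) : ℂ)‖ₑ ^ 2 = 1 := by
  have hN' : (0 : ℝ) < N := by positivity
  rw [← ofReal_norm, Complex.norm_real, Real.norm_of_nonneg (by positivity),
    ← ENNReal.ofReal_pow (by positivity), div_pow, one_pow, Real.sq_sqrt hN'.le,
    ← ENNReal.ofReal_natCast, ← ENNReal.ofReal_mul hN'.le, mul_one_div_cancel hN'.ne',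
    ENNReal.ofReal_one]

/-- On the piece `{τ = ζ}` the map `ω ↦ ζ⁻¹ c(α^* ω)` is the identity, so that the integral over
`ν'_{i,ζ}` pulls back to the one over this piece; the pieces add up to the whole space. -/
theorem isL2Isometry_dilation (hα : 1 < α.range.index) (hcm : Measurable c)
    (hc : ∀ ω, dualEnd α (c ω) = ω) (ν : ι → Measure (PontryaginDual Γ)) :
    IsL2Isometry ν (dilMeasure α c ν) fun F p ω =>
      ((1 / Real.sqrt (dilIndex α) : ℝ) : ℂ) * F p.1 ((p.2 : PontryaginDual Γ)⁻¹ * c ω) where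
  measurable F hF p := ((hF p.1).comp (hcm.const_mul _)).const_mul _
  map_add F K _ _ p := .of_forall fun ω => mul_add _ _ _
  map_smul a F _ p := .of_forall fun ω => mul_left_comm _ _ _
  energy_eq F hF := by
    rw [energy, energy, ENNReal.tsum_prod']
    refine tsum_congr fun i => ?_
    conv_rhs => rw [← sum_restrict_tau hα hcm hc (ν i), lintegral_sum_measure]
    refine tsum_congr fun k => ?_
    have hm : Measurable fun ω => ‖((1 / Real.sqrt (dilIndex α) : ℝ) : ℂ) *
        F i ((k : PontryaginDual Γ)⁻¹ * c ω)‖ₑ ^ 2 :=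
      (((hF i).comp (hcm.const_mul _)).const_mul _).enorm.pow_const 2
    rw [dilMeasure, lintegral_smul_measure, lintegral_map hm (continuous_dualEnd α).measurable,
      smul_eq_mul]
    have hm' : Measurable fun ω => ‖((1 / Real.sqrt (dilIndex α) : ℝ) : ℂ) *
        F i ((k : PontryaginDual Γ)⁻¹ * c (dualEnd α ω))‖ₑ ^ 2 :=
      hm.comp (continuous_dualEnd α).measurable
    rw [← lintegral_const_mul _ hm']
    refine setLIntegral_congr_fun (measurableSet_tau_eq hcm _) fun ω hω => ?_
    have hω' : (k : PontryaginDual Γ)⁻¹ * c (dualEnd α ω) = ω := by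
      rw [← show tau α c ω = k from hω, tau_inv_mul_section]
    have hN : dilIndex α ≠ 0 := by rw [dilIndex]; omega
    rw [hω', enorm_mul, mul_pow, ← mul_assoc, enorm_sqrt_inv_sq hN, one_mul]

/-- The family `Fᵢ(ω) = √N K_{i,τ(ω)}(α^* ω)` has dilation `K`. -/
theorem exists_dilation_eq (hα : 1 < α.range.index) (hcm : Measurable c)
    (hc : ∀ ω, dualEnd α (c ω) = ω) (K : ι × (dualEnd α).ker → PontryaginDual Γ → ℂ)
    (hK : ∀ p, Measurable (K p)) :
    ∃ F : ι → PontryaginDual Γ → ℂ, (∀ i, Measurable (F i)) ∧ ∀ p ω,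
      ((1 / Real.sqrt (dilIndex α) : ℝ) : ℂ) * F p.1 ((p.2 : PontryaginDual Γ)⁻¹ * c ω) =
        K p ω := by
  have := finite_ker_dualEnd α hα
  have := Fintype.ofFinite (dualEnd α).ker
  classical
  refine ⟨fun i ω => (Real.sqrt (dilIndex α) : ℂ) * ∑ k : (dualEnd α).ker,
    {ω | tau α c ω = k}.indicator (fun ω => K (i, k) (dualEnd α ω)) ω, fun i => ?_, ?_⟩
  · exact (Finset.measurable_fun_sum _ fun k _ => ((hK (i, k)).comp
      (continuous_dualEnd α).measurable).indicator (measurableSet_tau_eq hcm _)).const_mul _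
  · rintro ⟨i, k⟩ ω
    have hN : (0 : ℝ) < dilIndex α := by rw [dilIndex]; exact_mod_cast (by omega)
    have hN' : (Real.sqrt (dilIndex α) : ℂ) ≠ 0 := by
      exact_mod_cast (Real.sqrt_pos.2 hN).ne'
    have hd := dualEnd_mul_section hc k⁻¹ ω
    rw [Subgroup.coe_inv] at hd
    have hs : ∀ l : (dualEnd α).ker,
        {ω | tau α c ω = l}.indicator (fun ω => K (i, l) (dualEnd α ω))
          ((k : PontryaginDual Γ)⁻¹ * c ω) = if l = k then K (i, k) ω else 0 := by
      intro l
      have ht := tau_mul_section hc k ω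
      have ht' : (k : PontryaginDual Γ)⁻¹ * c ω ∈ {ω | tau α c ω = k} := ht
      by_cases hl : l = k
      · rw [if_pos hl, hl, Set.indicator_of_mem ht', hd]
      · rw [if_neg hl, Set.indicator_of_notMem]
        exact fun h => hl (Subtype.ext ((show tau α c _ = l from h).symm.trans ht))
    simp only [hs, Finset.sum_ite_eq', Finset.mem_univ, if_true]
    rw [← mul_assoc, Complex.ofReal_div, Complex.ofReal_one, one_div_mul_cancel hN', one_mul]

/-- The dilation as a unitary operator. -/
def dilationEquiv (hα : 1 < α.range.index) (hcm : Measurable c)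
    (hc : ∀ ω, dualEnd α (c ω) = ω) (ν : ι → Measure (PontryaginDual Γ)) :
    L2Sum ν ≃ₗᵢ[ℂ] L2Sum (dilMeasure α c ν) :=
  (isL2Isometry_dilation hα hcm hc ν).toEquiv fun K hK =>
    let ⟨F, hF, h⟩ := exists_dilation_eq hα hcm hc K hK
    ⟨F, hF, fun p => .of_forall (h p)⟩

/-- All points `ζ⁻¹ c(ω)` of the fibre over `ω` satisfy `(ζ⁻¹ c(ω))(α γ) = ω(γ)`. -/
theorem dilation_charMul (hα : 1 < α.range.index) (hcm : Measurable c)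
    (hc : ∀ ω, dualEnd α (c ω) = ω) (ν : ι → Measure (PontryaginDual Γ)) (γ : Γ) (f : L2Sum ν) :
    dilation α c ν (charMul (α γ) f) = charMul γ (dilation α c ν f) := by
  have hD := isL2Isometry_dilation hα hcm hc ν
  refine L2Sum.ext_ae fun p => ?_
  have hm : ∀ i, Measurable fun ω : PontryaginDual Γ => (ω (α γ) : ℂ) * f i ω :=
    fun i => (measurable_eval _).mul (f.measurable_coe i)
  have hd := fun ω => dualEnd_mul_section hc p.2⁻¹ ω
  filter_upwards [hD.coe_toL2Sum_of_ae hm (coe_charMul (α γ) f) p,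
    coe_charMul γ (dilation α c ν f) p, hD.coe_toL2Sum f p] with ω h1 h2 h3
  refine h1.trans (Eq.trans ?_ h2.symm)
  rw [show dilation α c ν f p ω = _ from h3, ← dualEnd_apply, ← Subgroup.coe_inv, hd,
    mul_left_comm]

end Dilation

/-! ### Matrices with orthogonal rows -/

section OrthogonalRows

variable {ι : Type v} {P : Type w} [Fintype P] {R : Finset ι} {N : ℕ} {B : ι → P → ℂ}

theorem eq_zero_of_sum_mul_conj_eq_zero {b : P → ℂ} (h : ∑ p, b p * conj (b p) = 0) (p : P) :
    b p = 0 := by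
  have h' : ∑ p, ‖b p‖ ^ 2 = 0 := by
    have : ((∑ p, ‖b p‖ ^ 2 : ℝ) : ℂ) = 0 := by
      rw [← h]
      push_cast
      exact Finset.sum_congr rfl fun p _ => (Complex.mul_conj' _).symm
    exact_mod_cast this
  have := (Finset.sum_eq_zero_iff_of_nonneg fun p _ => sq_nonneg ‖b p‖).1 h' p (Finset.mem_univ p)
  simpa using this

/-- Linear combinations of orthogonal rows with square norm `N` satisfy Pythagoras' theorem. -/
theorem sum_norm_sq_of_orthogonal (hoff : ∀ i i', i ≠ i' → ∑ p, B i p * conj (B i' p) = 0)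
    (hdiag : ∀ i ∈ R, ∑ p, B i p * conj (B i p) = N) (x : ι → ℂ) :
    ∑ p, ‖∑ i ∈ R, B i p * x i‖ ^ 2 = N * ∑ i ∈ R, ‖x i‖ ^ 2 := by
  classical
  have h : ∑ p, (∑ i ∈ R, B i p * x i) * conj (∑ i ∈ R, B i p * x i) =
      N * ∑ i ∈ R, x i * conj (x i) := by
    simp_rw [map_sum, Finset.sum_mul_sum, map_mul]
    rw [Finset.sum_comm, Finset.mul_sum]
    refine Finset.sum_congr rfl fun i hi => ?_
    rw [Finset.sum_comm, Finset.sum_eq_single i]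
    · rw [← hdiag i hi, Finset.sum_mul]
      exact Finset.sum_congr rfl fun p _ => by ring
    · intro i' _ hne
      have h0 := hoff i i' hne.symm
      calc ∑ p, B i p * x i * (conj (B i' p) * conj (x i'))
          = (∑ p, B i p * conj (B i' p)) * (x i * conj (x i')) := by
            rw [Finset.sum_mul]
            exact Finset.sum_congr rfl fun p _ => by ring
        _ = 0 := by rw [h0, zero_mul]
    · exact fun h => absurd hi h
  simp_rw [Complex.mul_conj'] at h
  exact_mod_cast h

/-- A square matrix with orthogonal rows of square norm `N` has orthogonal columns of square
norm `N`, so that every vector is a combination of its rows. -/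
theorem sum_mul_sum_conj_of_orthogonal (hN : N ≠ 0)
    (hoff : ∀ i i', i ≠ i' → ∑ p, B i p * conj (B i' p) = 0)
    (hdiag : ∀ i ∈ R, ∑ p, B i p * conj (B i p) = N) (hcard : R.card = Fintype.card P)
    (y : P → ℂ) (p : P) :
    ∑ i ∈ R, B i p * ((N : ℂ)⁻¹ * ∑ q, conj (B i q) * y q) = y p := by
  classical
  have hN' : (N : ℂ) ≠ 0 := Nat.cast_ne_zero.2 hN
  let M : Matrix R P ℂ := Matrix.of fun i p => B i p
  let M' : Matrix P R ℂ := Matrix.of fun p i => (N : ℂ)⁻¹ * conj (B i p)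
  have h1 : M * M' = 1 := by
    ext i i'
    have he : (M * M') i i' = (N : ℂ)⁻¹ * ∑ p, B i p * conj (B i' p) := by
      rw [Matrix.mul_apply, Finset.mul_sum]
      exact Finset.sum_congr rfl fun p _ => mul_left_comm _ _ _
    rw [he, Matrix.one_apply]
    by_cases hii : i = i'
    · rw [if_pos hii, hii, hdiag _ i'.2, inv_mul_cancel₀ hN']
    · rw [if_neg hii, hoff _ _ fun h => hii (Subtype.ext h), mul_zero]
  -- a one-sided inverse of a square matrix is two-sided
  have h2 : M' * M = 1 :=
    (Matrix.mul_eq_one_comm_of_card_eq _ _ _ (by rw [Fintype.card_coe, hcard])).1 h1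
  have h3 : ∀ q, ∑ i ∈ R, B i p * ((N : ℂ)⁻¹ * conj (B i q)) = if q = p then 1 else 0 := by
    intro q
    have := congrFun (congrFun h2 q) p
    rw [Matrix.mul_apply, Matrix.one_apply] at this
    rw [← this, ← Finset.sum_coe_sort R]
    exact Finset.sum_congr rfl fun i _ => mul_comm _ _
  calc ∑ i ∈ R, B i p * ((N : ℂ)⁻¹ * ∑ q, conj (B i q) * y q)
      = ∑ i ∈ R, ∑ q, B i p * ((N : ℂ)⁻¹ * conj (B i q)) * y q := by
        refine Finset.sum_congr rfl fun i _ => ?_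
        rw [Finset.mul_sum, Finset.mul_sum]
        exact Finset.sum_congr rfl fun q _ => by ring
    _ = y p := by
        rw [Finset.sum_comm]
        simp_rw [← Finset.sum_mul, h3]
        simp

end OrthogonalRows

/-! ### Ruelle operators -/

section Ruelle

theorem measurableSet_levelSet {X : Type*} [MeasurableSpace X] {m : X → ℕ} (hm : Measurable m)
    (j : ℕ) : MeasurableSet (levelSet m j) :=
  measurableSet_lt measurable_const hm

variable {Γ : Type u} [CommGroup Γ] [TopologicalSpace Γ] [DiscreteTopology Γ]
  {α : Γ →* Γ} {c : PontryaginDual Γ → PontryaginDual Γ} {m : PontryaginDual Γ → ℕ}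
  {ι : Type v} {E : ι → Set (PontryaginDual Γ)} {A : ι → ℕ → PontryaginDual Γ → ℂ}

/-- `A` is a matrix of Borel functions with an arbitrary set `ι` of rows that satisfies the filter
equation with respect to the sets `E i`, which form a point-finite family.  Besides `H` and `G`
this covers the matrix composed of `H` and `G`, which has `ℕ ⊕ ℕ` as its set of rows. -/
structure IsFilterSystem [MeasurableSpace (PontryaginDual Γ)]
    (μ : Measure (PontryaginDual Γ)) (α : Γ →* Γ)
    (m : PontryaginDual Γ → ℕ) (E : ι → Set (PontryaginDual Γ))
    (A : ι → ℕ → PontryaginDual Γ → ℂ) : Prop where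
  measurableSet : ∀ i, MeasurableSet (E i)
  finite : ∀ ω, {i | ω ∈ E i}.Finite
  measurable : ∀ i j, Measurable (A i j)
  support : ∀ i j, ∀ᵐ ω ∂μ, ω ∉ levelSet m j → A i j ω = 0
  off_diag : ∀ i i', i ≠ i' → ∀ᵐ ω ∂μ, rowProduct α (A i) (A i') ω = 0
  diag : ∀ i, ∀ᵐ ω ∂μ, rowProduct α (A i) (A i) ω = (dilIndex α : ℂ) * (E i).indicator 1 ω

/-- The conditions of `IsFilterSystem` at all points of the fibre `{k c(ω) : k ∈ ker α^*}` of
`α^*` over `ω`. -/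
structure IsFilterFibre (α : Γ →* Γ) (c : PontryaginDual Γ → PontryaginDual Γ)
    (m : PontryaginDual Γ → ℕ) (E : ι → Set (PontryaginDual Γ))
    (A : ι → ℕ → PontryaginDual Γ → ℂ) (ω : PontryaginDual Γ) : Prop where
  finite : {i | ω ∈ E i}.Finite
  support : ∀ (k : (dualEnd α).ker) (i : ι) (j : ℕ),
    (k : PontryaginDual Γ) * c ω ∉ levelSet m j → A i j (k * c ω) = 0
  off_diag : ∀ i i', i ≠ i' → rowProduct α (A i) (A i') ω = 0
  diag : ∀ i, rowProduct α (A i) (A i) ω = (dilIndex α : ℂ) * (E i).indicator 1 ω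

/-- The columns of the matrix over `ω`: the pairs of a point `k c(ω)` of the fibre of `α^*` and an
index `j` with `k c(ω) ∈ σ_j`. -/
abbrev FibreColumn (α : Γ →* Γ) (c : PontryaginDual Γ → PontryaginDual Γ)
    (m : PontryaginDual Γ → ℕ) (ω : PontryaginDual Γ) : Type u :=
  Σ k : (dualEnd α).ker, Fin (m (k * c ω))

namespace IsFilterFibre

variable {ω : PontryaginDual Γ}

/-- The matrix over `ω`. -/
def matrix (α : Γ →* Γ) (c : PontryaginDual Γ → PontryaginDual Γ) (m : PontryaginDual Γ → ℕ)
    (A : ι → ℕ → PontryaginDual Γ → ℂ) (ω : PontryaginDual Γ) (i : ι)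
    (p : FibreColumn α c m ω) : ℂ :=
  A i p.2 (p.1 * c ω)

theorem tsum_eq_sum_fin {M : Type*} [AddCommMonoid M] [TopologicalSpace M] {f : ℕ → M} {n : ℕ}
    (h : ∀ j, ¬ j < n → f j = 0) : ∑' j, f j = ∑ j : Fin n, f j := by
  rw [tsum_eq_sum (s := Finset.range n) fun j hj => h j fun h' => hj (Finset.mem_range.2 h'),
    Finset.sum_range]

section Fintype

variable [Fintype (dualEnd α).ker]

theorem rowProduct_eq (h : IsFilterFibre α c m E A ω) (hc : ∀ ω, dualEnd α (c ω) = ω)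
    (i i' : ι) : rowProduct α (A i) (A i') ω =
      ∑ p, matrix α c m A ω i p * conj (matrix α c m A ω i' p) := by
  rw [rowProduct, finsum_fibre hc, Fintype.sum_sigma]
  refine Finset.sum_congr rfl fun k _ => ?_
  exact tsum_eq_sum_fin fun j hj => by rw [h.support k i j hj, zero_mul]

theorem sum_matrix_eq (h : IsFilterFibre α c m E A ω) (hc : ∀ ω, dualEnd α (c ω) = ω)
    {i i' : ι} (hne : i ≠ i') :
    ∑ p, matrix α c m A ω i p * conj (matrix α c m A ω i' p) = 0 := by
  rw [← h.rowProduct_eq hc, h.off_diag i i' hne]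

theorem sum_matrix_self (h : IsFilterFibre α c m E A ω) (hc : ∀ ω, dualEnd α (c ω) = ω)
    {i : ι} (hi : i ∈ h.finite.toFinset) :
    ∑ p, matrix α c m A ω i p * conj (matrix α c m A ω i p) = dilIndex α := by
  have hi' : ω ∈ E i := by simpa using hi
  rw [← h.rowProduct_eq hc, h.diag, Set.indicator_of_mem hi', Pi.one_apply, mul_one]

/-- The rows whose set `E i` does not contain `ω` vanish over `ω`. -/
theorem apply_eq_zero (h : IsFilterFibre α c m E A ω) (hc : ∀ ω, dualEnd α (c ω) = ω)
    {i : ι} (hi : i ∉ h.finite.toFinset) (k : (dualEnd α).ker) (j : ℕ) :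
    A i j (k * c ω) = 0 := by
  by_cases hj : (k : PontryaginDual Γ) * c ω ∈ levelSet m j
  · have hi' : ω ∉ E i := by simpa using hi
    have h0 := h.rowProduct_eq hc i i
    rw [h.diag, Set.indicator_of_notMem hi', mul_zero] at h0
    exact eq_zero_of_sum_mul_conj_eq_zero h0.symm ⟨k, ⟨j, hj⟩⟩
  · exact h.support k i j hj

theorem tsum_apply_mul (h : IsFilterFibre α c m E A ω) (hc : ∀ ω, dualEnd α (c ω) = ω)
    (k : (dualEnd α).ker) (j : ℕ) (x : ι → ℂ) :
    ∑' i, A i j (k * c ω) * x i = ∑ i ∈ h.finite.toFinset, A i j (k * c ω) * x i :=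
  tsum_eq_sum fun i hi => by rw [h.apply_eq_zero hc hi, zero_mul]

theorem summable_apply_mul (h : IsFilterFibre α c m E A ω) (hc : ∀ ω, dualEnd α (c ω) = ω)
    (k : (dualEnd α).ker) (j : ℕ) (x : ι → ℂ) : Summable fun i => A i j (k * c ω) * x i :=
  summable_of_ne_finset_zero (s := h.finite.toFinset)
    fun i hi => by rw [h.apply_eq_zero hc hi, zero_mul]

/-- The rows over `ω` are orthogonal, which makes `x ↦ (∑ᵢ A_{i,j}(ζ) xᵢ)_{ζ,j}` a multiple of an
isometry. -/
theorem sum_enorm_sq (h : IsFilterFibre α c m E A ω) (hc : ∀ ω, dualEnd α (c ω) = ω)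
    (x : ι → ℂ) :
    ∑ k : (dualEnd α).ker, ∑' j, ‖∑' i, A i j (k * c ω) * x i‖ₑ ^ 2 =
      dilIndex α * ∑' i, (E i).indicator (fun _ => ‖x i‖ₑ ^ 2) ω := by
  have hr : ∀ z : ℂ, ‖z‖ₑ ^ 2 = ENNReal.ofReal (‖z‖ ^ 2) := fun z => by
    rw [ENNReal.ofReal_pow (norm_nonneg _), ofReal_norm]
  have h1 : ∀ k : (dualEnd α).ker, ∑' j, ‖∑' i, A i j (k * c ω) * x i‖ₑ ^ 2 =
      ∑ j : Fin (m (k * c ω)), ‖∑ i ∈ h.finite.toFinset,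
        matrix α c m A ω i ⟨k, j⟩ * x i‖ₑ ^ 2 := by
    intro k
    simp_rw [h.tsum_apply_mul hc]
    refine tsum_eq_sum_fin fun j hj => ?_
    rw [Finset.sum_eq_zero fun i _ => by rw [h.support k i j hj, zero_mul]]
    simp
  have h2 : ∑' i, (E i).indicator (fun _ => ‖x i‖ₑ ^ 2) ω =
      ∑ i ∈ h.finite.toFinset, ‖x i‖ₑ ^ 2 := by
    rw [tsum_eq_sum (s := h.finite.toFinset) fun i hi =>
      Set.indicator_of_notMem (by simpa using hi) _]
    exact Finset.sum_congr rfl fun i hi => Set.indicator_of_mem (by simpa using hi) _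
  simp_rw [h1]
  rw [h2, ← Fintype.sum_sigma (fun p : FibreColumn α c m ω => ‖∑ i ∈ h.finite.toFinset,
        matrix α c m A ω i p * x i‖ₑ ^ 2)]
  simp_rw [hr]
  rw [← ENNReal.ofReal_sum_of_nonneg fun _ _ => by positivity,
    ← ENNReal.ofReal_sum_of_nonneg fun _ _ => by positivity,
    sum_norm_sq_of_orthogonal (fun i i' hne => h.sum_matrix_eq hc hne)
      (fun i hi => h.sum_matrix_self hc hi),
    ENNReal.ofReal_mul (by positivity), ENNReal.ofReal_natCast]

/-- If there are as many rows as columns over `ω`, then `x ↦ (∑ᵢ A_{i,j}(ζ) xᵢ)_{ζ,j}` is onto. -/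
theorem tsum_mul_sum_conj (h : IsFilterFibre α c m E A ω) (hc : ∀ ω, dualEnd α (c ω) = ω)
    (hN : dilIndex α ≠ 0)
    (hcard : h.finite.toFinset.card = fiberSum α m ω) (K : ℕ → PontryaginDual Γ → ℂ)
    (k : (dualEnd α).ker) (j : ℕ) (hj : (k : PontryaginDual Γ) * c ω ∈ levelSet m j) :
    ∑' i, A i j (k * c ω) * ((dilIndex α : ℂ)⁻¹ *
      ∑ l : (dualEnd α).ker, ∑' j, conj (A i j (l * c ω)) * K j (l * c ω)) = K j (k * c ω) := by
  have hP : Fintype.card (FibreColumn α c m ω) = fiberSum α m ω := by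
    rw [fiberSum, finsum_fibre hc, Fintype.card_sigma]
    simp
  have h1 : ∀ i, ∑ l : (dualEnd α).ker, ∑' j, conj (A i j (l * c ω)) * K j (l * c ω) =
      ∑ p : FibreColumn α c m ω, conj (matrix α c m A ω i p) * K p.2 (p.1 * c ω) := by
    intro i
    rw [Fintype.sum_sigma]
    refine Finset.sum_congr rfl fun l _ => ?_
    exact tsum_eq_sum_fin fun j hj => by rw [h.support l i j hj, map_zero, zero_mul]
  rw [h.tsum_apply_mul hc]
  simp_rw [h1]
  exact sum_mul_sum_conj_of_orthogonal hN (fun i i' hne => h.sum_matrix_eq hc hne)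
    (fun i hi => h.sum_matrix_self hc hi) (hcard.trans hP.symm)
    (fun p : FibreColumn α c m ω => K p.2 (p.1 * c ω)) ⟨k, ⟨j, hj⟩⟩

end Fintype

end IsFilterFibre

/-- The action of the Ruelle operator on functions. -/
def ruelleFun (α : Γ →* Γ) (A : ι → ℕ → PontryaginDual Γ → ℂ) (F : ι → PontryaginDual Γ → ℂ)
    (j : ℕ) (ω : PontryaginDual Γ) : ℂ :=
  ∑' i, A i j ω * F i (dualEnd α ω)

namespace IsFilterSystem

variable [MeasurableSpace (PontryaginDual Γ)] [BorelSpace (PontryaginDual Γ)]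
  {μ : Measure (PontryaginDual Γ)} [Countable ι]

theorem measurable_ruelleFun (h : IsFilterSystem μ α m E A) {F : ι → PontryaginDual Γ → ℂ}
    (hF : ∀ i, Measurable (F i)) (j : ℕ) : Measurable (ruelleFun α A F j) :=
  Measurable.tsum fun i => (h.measurable i j).mul ((hF i).comp (continuous_dualEnd α).measurable)

variable [μ.IsHaarMeasure]

theorem ae_isFilterFibre (h : IsFilterSystem μ α m E A) (hα : 1 < α.range.index)
    (hcm : Measurable c) (hc : ∀ ω, dualEnd α (c ω) = ω) :
    ∀ᵐ ω ∂μ, IsFilterFibre α c m E A ω := by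
  have h1 : ∀ᵐ ω ∂μ, ∀ i j, ω ∉ levelSet m j → A i j ω = 0 :=
    ae_all_iff.2 fun i => ae_all_iff.2 fun j => h.support i j
  have h2 : ∀ᵐ ω ∂μ, ∀ i i', i ≠ i' → rowProduct α (A i) (A i') ω = 0 :=
    ae_all_iff.2 fun i => ae_all_iff.2 fun i' => ae_all_iff.2 (h.off_diag i i')
  filter_upwards [ae_forall_fibre hα hcm hc h1, h2, ae_all_iff.2 h.diag] with ω a1 a2 a3
  exact ⟨h.finite ω, fun k i j => a1 k i j, a2, a3⟩

/-- Almost everywhere the sum that defines the Ruelle operator has finitely many nonzero terms,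
whatever values the functions `F i` take off `E i`. -/
theorem ae_summable (h : IsFilterSystem μ α m E A) (hα : 1 < α.range.index)
    (hcm : Measurable c) (hc : ∀ ω, dualEnd α (c ω) = ω) :
    ∀ᵐ ζ ∂μ, ∀ (j : ℕ) (x : ι → ℂ), Summable fun i => A i j ζ * x i := by
  have := finite_ker_dualEnd α hα
  have := Fintype.ofFinite (dualEnd α).ker
  refine ae_of_ae_forall_fibre hc ?_
  filter_upwards [h.ae_isFilterFibre hα hcm hc] with ω hω k j x
  exact hω.summable_apply_mul hc k j x

/-- The integral over the fibres of `α^*` reduces the isometry property of the Ruelle operator to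
the one of the finite matrices over almost every point. -/
theorem isL2Isometry_ruelleFun (h : IsFilterSystem μ α m E A) (hm : Measurable m)
    (hα : 1 < α.range.index) (hcm : Measurable c) (hc : ∀ ω, dualEnd α (c ω) = ω) :
    IsL2Isometry (fun i => μ.restrict (E i)) (fun j => μ.restrict (levelSet m j))
      (ruelleFun α A) where
  measurable F hF := h.measurable_ruelleFun hF
  map_add F K _ _ j := ae_restrict_of_ae <| by
    filter_upwards [h.ae_summable hα hcm hc] with ζ hs
    rw [ruelleFun, ruelleFun, ruelleFun, ← (hs j _).tsum_add (hs j _)]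
    exact tsum_congr fun i => mul_add _ _ _
  map_smul a F _ j := .of_forall fun ζ => by
    simp only [ruelleFun]
    rw [← tsum_mul_left]
    exact tsum_congr fun i => mul_left_comm _ _ _
  energy_eq F hF := by
    have := finite_ker_dualEnd α hα
    have := Fintype.ofFinite (dualEnd α).ker
    have hN : dilIndex α ≠ 0 := by rw [dilIndex]; omega
    have hRm : ∀ j, Measurable fun ζ => ‖ruelleFun α A F j ζ‖ₑ ^ 2 :=
      fun j => (h.measurable_ruelleFun hF j).enorm.pow_const 2
    -- the restriction to `σ_j` may be dropped, as the `j`-th column is supported there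
    have h1 : energy (fun j => μ.restrict (levelSet m j)) (ruelleFun α A F) =
        ∫⁻ ζ, ∑' j, ‖ruelleFun α A F j ζ‖ₑ ^ 2 ∂μ := by
      rw [lintegral_tsum fun j => (hRm j).aemeasurable]
      refine tsum_congr fun j => ?_
      rw [← lintegral_indicator (measurableSet_levelSet hm j)]
      refine lintegral_congr_ae ?_
      filter_upwards [ae_all_iff.2 fun i => h.support i j] with ζ hζ
      by_cases hj : ζ ∈ levelSet m j
      · rw [Set.indicator_of_mem hj]
      · have : ruelleFun α A F j ζ = 0 := by
          rw [ruelleFun]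
          simp [hζ _ hj]
        rw [Set.indicator_of_notMem hj, this]
        simp
    have h2 : energy (fun i => μ.restrict (E i)) F =
        ∫⁻ ω, ∑' i, (E i).indicator (fun _ => ‖F i ω‖ₑ ^ 2) ω ∂μ := by
      have hi : ∀ i ω, (E i).indicator (fun _ => ‖F i ω‖ₑ ^ 2) ω =
          (E i).indicator (fun ω => ‖F i ω‖ₑ ^ 2) ω := fun i ω => rfl
      simp_rw [hi]
      rw [lintegral_tsum fun i =>
        (((hF i).enorm.pow_const 2).indicator (h.measurableSet i)).aemeasurable]
      exact tsum_congr fun i => (lintegral_indicator (h.measurableSet i) _).symm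
    have h3 : (dilIndex α : ℝ≥0∞) * ∫⁻ ζ, ∑' j, ‖ruelleFun α A F j ζ‖ₑ ^ 2 ∂μ =
        dilIndex α * ∫⁻ ω, ∑' i, (E i).indicator (fun _ => ‖F i ω‖ₑ ^ 2) ω ∂μ := by
      rw [← lintegral_sum_fibre hα hcm hc (Measurable.tsum hRm).aemeasurable,
        ← lintegral_const_mul']
      · refine lintegral_congr_ae ?_
        filter_upwards [h.ae_isFilterFibre hα hcm hc] with ω hω
        rw [← hω.sum_enorm_sq hc]
        simp only [ruelleFun, dualEnd_mul_section hc]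
      · exact ENNReal.natCast_ne_top _
    rw [h1, h2]
    exact (ENNReal.mul_right_inj (Nat.cast_ne_zero.2 hN) (ENNReal.natCast_ne_top _)).1 h3

/-- If almost everywhere there are as many rows as columns, then the Ruelle operator is onto. -/
theorem exists_ruelleFun_eq (h : IsFilterSystem μ α m E A) (hm : Measurable m)
    (hα : 1 < α.range.index) (hcm : Measurable c) (hc : ∀ ω, dualEnd α (c ω) = ω)
    (hcard : ∀ᵐ ω ∂μ, (h.finite ω).toFinset.card = fiberSum α m ω)
    (K : ℕ → PontryaginDual Γ → ℂ) (hK : ∀ j, Measurable (K j)) :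
    ∃ F : ι → PontryaginDual Γ → ℂ, (∀ i, Measurable (F i)) ∧
      ∀ j, ruelleFun α A F j =ᵐ[μ.restrict (levelSet m j)] K j := by
  have := finite_ker_dualEnd α hα
  have := Fintype.ofFinite (dualEnd α).ker
  have hN : dilIndex α ≠ 0 := by rw [dilIndex]; omega
  -- over each point, `F` is the adjoint matrix applied to `K`, divided by `N`
  refine ⟨fun i ω => (dilIndex α : ℂ)⁻¹ *
      ∑ l : (dualEnd α).ker, ∑' j, conj (A i j (l * c ω)) * K j (l * c ω), fun i => ?_, ?_⟩
  · refine (Finset.measurable_fun_sum _ fun l _ => Measurable.tsum fun j => ?_).const_mul _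
    have hl := measurable_mul_section hcm l
    exact (Complex.continuous_conj.measurable.comp ((h.measurable i j).comp hl)).mul
      ((hK j).comp hl)
  · have h1 : ∀ᵐ ζ ∂μ, ∀ j, ζ ∈ levelSet m j → ruelleFun α A (fun i ω => (dilIndex α : ℂ)⁻¹ *
        ∑ l : (dualEnd α).ker, ∑' j, conj (A i j (l * c ω)) * K j (l * c ω)) j ζ = K j ζ := by
      refine ae_of_ae_forall_fibre hc ?_
      filter_upwards [h.ae_isFilterFibre hα hcm hc, hcard] with ω hω hcω k j hj
      rw [ruelleFun, dualEnd_mul_section hc]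
      exact hω.tsum_mul_sum_conj hc hN hcω K k j hj
    exact fun j => (ae_restrict_iff' (measurableSet_levelSet hm j)).2 <| h1.mono fun ζ hζ => hζ j

end IsFilterSystem

end Ruelle

/-! ### Unitary operators on `V ⊕ ⨁ₙ Wₙ` -/

section Abstract

variable {V : Type*} {W : ℕ → Type*} [∀ n, NormedAddCommGroup (W n)]

theorem prodLp_ext {f g : WithLp 2 (V × lp W 2)} (h1 : f.fst = g.fst)
    (h2 : ∀ n, f.snd n = g.snd n) : f = g := by
  apply WithLp.ofLp_injective
  exact Prod.ext h1 (lp.ext (funext h2))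

variable [NormedAddCommGroup V]

theorem hasSum_snd_norm_sq (f : WithLp 2 (V × lp W 2)) :
    HasSum (fun n => ‖f.snd n‖ ^ 2) (‖f‖ ^ 2 - ‖f.fst‖ ^ 2) := by
  rw [WithLp.prod_norm_sq_eq_of_L2, add_sub_cancel_left]
  exact hasSum_norm_sq f.snd

/-- The elements with finitely many nonzero coordinates are dense. -/
theorem dense_setOf_eventually_zero :
    Dense {f : WithLp 2 (V × lp W 2) | ∃ N, ∀ n, N ≤ n → f.snd n = 0} := by
  classical
  intro f
  have h : Filter.Tendsto (fun s : Finset ℕ =>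
      WithLp.toLp 2 (f.fst, ∑ n ∈ s, lp.single 2 n (f.snd n))) Filter.atTop (nhds f) :=
    ((WithLp.prod_continuous_toLp 2 V (lp W 2)).tendsto _).comp
      (tendsto_const_nhds.prodMk_nhds (lp.hasSum_single (by norm_num) f.snd))
  refine mem_closure_of_tendsto h (.of_forall fun s => ⟨s.sup id + 1, fun n hn => ?_⟩)
  change (∑ i ∈ s, lp.single 2 i (f.snd i) : lp W 2) n = 0
  rw [lp.coeFn_sum, Finset.sum_apply]
  refine Finset.sum_eq_zero fun i hi => lp.single_apply_ne _ _ _ ?_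
  have := Finset.le_sup (f := id) hi
  simp only [id] at this
  omega

variable [∀ n, NormedSpace ℂ (W n)]

theorem separableSpace_lp {ι : Type*} [Countable ι] {E : ι → Type*}
    [∀ i, NormedAddCommGroup (E i)] [∀ i, NormedSpace ℂ (E i)]
    [∀ i, TopologicalSpace.SeparableSpace (E i)] : TopologicalSpace.SeparableSpace (lp E 2) := by
  classical
  rw [← TopologicalSpace.isSeparable_univ_iff]
  have h : TopologicalSpace.IsSeparable
      (⋃ i, Set.range (lp.single (E := E) 2 i)) :=
    .iUnion fun i => TopologicalSpace.isSeparable_range (lp.isometry_single i).continuous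
  refine (h.span (R := ℂ)).closure.mono fun f _ => ?_
  refine mem_closure_of_tendsto (lp.hasSum_single (by norm_num) f) (.of_forall fun s => ?_)
  exact Submodule.sum_mem _ fun i _ =>
    Submodule.subset_span (Set.mem_iUnion.2 ⟨i, f i, rfl⟩)

theorem separableSpace_prodLp [TopologicalSpace.SeparableSpace V]
    [∀ n, TopologicalSpace.SeparableSpace (W n)] :
    TopologicalSpace.SeparableSpace (WithLp 2 (V × lp W 2)) := by
  have := separableSpace_lp (E := W)
  exact (WithLp.toLp_surjective 2).denseRange.separableSpace
    (WithLp.prod_continuous_toLp 2 V (lp W 2))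

variable [NormedSpace ℂ V]

/-- The linear isometry of `V ⊕ ⨁ₙ Wₙ` with given coordinates. -/
def isometryOfCoords (P : WithLp 2 (V × lp W 2) →ₗ[ℂ] V)
    (Q : ∀ n, WithLp 2 (V × lp W 2) →ₗ[ℂ] W n)
    (h : ∀ f, HasSum (fun n => ‖Q n f‖ ^ 2) (‖f‖ ^ 2 - ‖P f‖ ^ 2)) :
    WithLp 2 (V × lp W 2) →ₗᵢ[ℂ] WithLp 2 (V × lp W 2) where
  toFun f := WithLp.toLp 2 (P f, ⟨fun n => Q n f, memℓp_two_of_summable (h f).summable⟩)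
  map_add' f g := prodLp_ext (map_add P f g) fun n => map_add (Q n) f g
  map_smul' a f := prodLp_ext (map_smul P a f) fun n => map_smul (Q n) a f
  norm_map' f := by
    refine (pow_left_inj₀ (norm_nonneg _) (norm_nonneg _) two_ne_zero).1 ?_
    have h' := (hasSum_norm_sq (⟨fun n => Q n f, memℓp_two_of_summable (h f).summable⟩ :
      lp W 2)).unique (h f)
    change ‖WithLp.toLp 2 (P f, (⟨fun n => Q n f, _⟩ : lp W 2))‖ ^ 2 = ‖f‖ ^ 2
    rw [WithLp.prod_norm_sq_eq_of_L2]
    exact (congrArg (‖P f‖ ^ 2 + ·) h').trans (add_sub_cancel _ _)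

/-- The projection to `V`. -/
def fstLin : WithLp 2 (V × lp W 2) →ₗ[ℂ] V where
  toFun f := f.fst
  map_add' _ _ := rfl
  map_smul' _ _ := rfl

/-- The projection to `Wₙ`. -/
def sndLin (n : ℕ) : WithLp 2 (V × lp W 2) →ₗ[ℂ] W n where
  toFun f := f.snd n
  map_add' _ _ := rfl
  map_smul' _ _ := rfl

/-- The subspace of the elements of `V ⊕ ⨁ₙ Wₙ` with vanishing components in all `Wₙ`, as the
space `V`. -/
def fstEquiv (K : Submodule ℂ (WithLp 2 (V × lp W 2))) (h : ∀ f, f ∈ K ↔ f.snd = 0) :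
    K ≃ₗᵢ[ℂ] V where
  toFun f := f.1.fst
  map_add' _ _ := rfl
  map_smul' _ _ := rfl
  invFun v := ⟨WithLp.toLp 2 (v, 0), (h _).2 rfl⟩
  left_inv f := Subtype.ext <| prodLp_ext rfl fun n => by
    rw [(h f).1 f.2, WithLp.toLp_snd]
  right_inv _ := rfl
  norm_map' f := by
    refine (pow_left_inj₀ (norm_nonneg _) (norm_nonneg _) two_ne_zero).1 ?_
    change ‖f.1.fst‖ ^ 2 = ‖f.1‖ ^ 2
    rw [WithLp.prod_norm_sq_eq_of_L2, (h f).1 f.2, norm_zero, zero_pow two_ne_zero, add_zero]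

theorem linearIsometryEquiv_mul_apply (A B : V ≃ₗᵢ[ℂ] V) (x : V) : (A * B) x = A (B x) := rfl

theorem linearIsometryEquiv_zpow_zero_apply (A : V ≃ₗᵢ[ℂ] V) (x : V) : (A ^ (0 : ℤ)) x = x := by
  rw [zpow_zero]
  rfl

/-- Unitary operators on the summands combine to one on `V ⊕ ⨁ₙ Wₙ`. -/
theorem exists_diagonal_equiv (e : V ≃ₗᵢ[ℂ] V) (d : ∀ n, W n ≃ₗᵢ[ℂ] W n) :
    ∃ U : WithLp 2 (V × lp W 2) ≃ₗᵢ[ℂ] WithLp 2 (V × lp W 2),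
      ∀ f, (U f).fst = e f.fst ∧ ∀ n, (U f).snd n = d n (f.snd n) := by
  have h : ∀ (e : V ≃ₗᵢ[ℂ] V) (d : ∀ n, W n ≃ₗᵢ[ℂ] W n) (f : WithLp 2 (V × lp W 2)),
      HasSum (fun n => ‖((d n).toLinearEquiv.toLinearMap ∘ₗ sndLin n) f‖ ^ 2)
        (‖f‖ ^ 2 - ‖(e.toLinearEquiv.toLinearMap ∘ₗ fstLin) f‖ ^ 2) := by
    intro e d f
    have := hasSum_snd_norm_sq f
    rw [← e.norm_map f.fst] at this
    simp_rw [← fun n => (d n).norm_map (f.snd n)] at this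
    exact this
  refine ⟨LinearIsometryEquiv.ofSurjective (isometryOfCoords _ _ (h e d)) fun g =>
    ⟨isometryOfCoords _ _ (h e.symm fun n => (d n).symm) g, ?_⟩, fun f => ⟨rfl, fun n => rfl⟩⟩
  exact prodLp_ext (e.apply_symm_apply g.fst) fun n => (d n).apply_symm_apply (g.snd n)

/-- A unitary `(v, w) ↦ S v + R w` from `V ⊕ W₀` to `V` and unitaries `Dₙ : Wₙ → Wₙ₊₁` combine to
a unitary operator on `V ⊕ ⨁ₙ Wₙ`. -/
theorem exists_shift_equiv (S : V →ₗ[ℂ] V) (R : W 0 →ₗ[ℂ] V) (D : ∀ n, W n ≃ₗᵢ[ℂ] W (n + 1))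
    (hnorm : ∀ v w, ‖S v + R w‖ ^ 2 = ‖v‖ ^ 2 + ‖w‖ ^ 2)
    (hsurj : ∀ u, ∃ v w, S v + R w = u) :
    ∃ T : WithLp 2 (V × lp W 2) ≃ₗᵢ[ℂ] WithLp 2 (V × lp W 2),
      ∀ f, (T f).fst = S f.fst + R (f.snd 0) ∧ ∀ n, (T f).snd n = (D n).symm (f.snd (n + 1)) := by
  let P : WithLp 2 (V × lp W 2) →ₗ[ℂ] V := S ∘ₗ fstLin + R ∘ₗ sndLin 0
  have h : ∀ f : WithLp 2 (V × lp W 2),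
      HasSum (fun n => ‖((D n).symm.toLinearEquiv.toLinearMap ∘ₗ sndLin (n + 1)) f‖ ^ 2)
        (‖f‖ ^ 2 - ‖P f‖ ^ 2) := by
    intro f
    have h1 := (hasSum_nat_add_iff' 1).2 (hasSum_snd_norm_sq f)
    simp_rw [← fun n => (D n).symm.norm_map (f.snd (n + 1))] at h1
    have h2 : ‖P f‖ ^ 2 = ‖f.fst‖ ^ 2 + ‖f.snd 0‖ ^ 2 :=
      hnorm f.fst (f.snd 0)
    rw [Finset.sum_range_one] at h1
    rw [h2, ← sub_sub]
    exact h1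
  refine ⟨LinearIsometryEquiv.ofSurjective (isometryOfCoords _ _ h) fun g => ?_,
    fun f => ⟨rfl, fun n => rfl⟩⟩
  obtain ⟨v, w, hvw⟩ := hsurj g.fst
  -- the components `w, D₀ g₀, D₁ g₁, …` of the preimage of `g`
  let b : ∀ n, W n := fun n => Nat.casesOn n w fun n => D n (g.snd n)
  have hb : Memℓp b 2 := by
    refine memℓp_two_of_summable ((summable_nat_add_iff 1).1 ?_)
    exact (hasSum_norm_sq g.snd).summable.congr fun n => by
      rw [show b (n + 1) = D n (g.snd n) from rfl, (D n).norm_map]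
  exact ⟨WithLp.toLp 2 (v, ⟨b, hb⟩), prodLp_ext hvw fun n => (D n).symm_apply_apply (g.snd n)⟩

end Abstract

/-! ### The matrix composed of a filter and a complementary filter -/

section Filters

/-- The family that defines `Cᵢ` is square integrable, as the measure is finite. -/
theorem coe_unitElement {X : Type u} [MeasurableSpace X] {μ : Measure X} [IsFiniteMeasure μ]
    {m : X → ℕ} (hm : Measurable m) (i l : ℕ) :
    unitElement μ m i l =ᵐ[μ.restrict (levelSet m l)]
      if l = i then (levelSet m i).indicator 1 else 0 := by
  have hmeas : ∀ l, Measurable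
      (if l = i then (levelSet m i).indicator 1 else 0 : X → ℂ) := fun l => by
    split_ifs
    · exact measurable_one.indicator (measurableSet_levelSet hm i)
    · exact measurable_zero
  refine toL2Sum_coe (exists_coe_eq (fun l => (hmeas l).aemeasurable) ?_) l
  rw [energy, tsum_eq_single i]
  · refine lt_of_le_of_lt (lintegral_mono (g := fun _ => 1) fun ω => ?_) (by simp)
    rw [if_pos rfl]
    by_cases h : ω ∈ levelSet m i
    · simp [Set.indicator_of_mem h]
    · simp [Set.indicator_of_notMem h]
  · intro l hl
    simp [hl]

theorem setOf_levelSet_eq {X : Type*} (r : X → ℕ) (ω : X) :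
    {i | ω ∈ levelSet r i} = (Finset.range (r ω) : Set ℕ) := by
  ext i
  simp [levelSet]

/-- The row index set over `ω` of the matrix composed of `H` and `G` has `m(ω) + m̃(ω)`
elements. -/
theorem ncard_rows {X : Type*} (m m' : X → ℕ) (ω : X)
    (hf : {i : ℕ ⊕ ULift.{u} ℕ | ω ∈ Sum.elim (levelSet m)
      (fun k : ULift.{u} ℕ => levelSet m' k.down) i}.Finite) :
    hf.toFinset.card = m ω + m' ω := by
  have : hf.toFinset = (Finset.range (m ω)).disjSum
      ((Finset.range (m' ω)).map Equiv.ulift.symm.toEmbedding) := by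
    ext (i | k)
    · simp [levelSet]
    · obtain ⟨k⟩ := k
      simp [levelSet, Equiv.ulift]
  rw [this, Finset.card_disjSum, Finset.card_map, Finset.card_range, Finset.card_range]

variable {Γ : Type u} [CommGroup Γ] [TopologicalSpace Γ] [DiscreteTopology Γ]
  {α : Γ →* Γ} {c : PontryaginDual Γ → PontryaginDual Γ} {m : PontryaginDual Γ → ℕ}
  {H G : ℕ → ℕ → PontryaginDual Γ → ℂ}

theorem rowProduct_conj (hα : 1 < α.range.index) (hc : ∀ ω, dualEnd α (c ω) = ω)
    (a b : ℕ → PontryaginDual Γ → ℂ) (ω : PontryaginDual Γ) :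
    conj (rowProduct α a b ω) = rowProduct α b a ω := by
  have := finite_ker_dualEnd α hα
  have := Fintype.ofFinite (dualEnd α).ker
  rw [rowProduct, rowProduct, finsum_fibre hc, finsum_fibre hc, map_sum]
  refine Finset.sum_congr rfl fun k _ => ?_
  rw [Complex.conj_tsum]
  exact tsum_congr fun j => by rw [map_mul, Complex.conj_conj, mul_comm]

variable [MeasurableSpace (PontryaginDual Γ)] {μ : Measure (PontryaginDual Γ)}

theorem isFilterSystem_of_isFilterMatrix {r : PontryaginDual Γ → ℕ} (hr : Measurable r)
    {A : ℕ → ℕ → PontryaginDual Γ → ℂ} (hA : IsFilterMatrix μ α m r A) :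
    IsFilterSystem μ α m (levelSet r) A where
  measurableSet := measurableSet_levelSet hr
  finite ω := by
    rw [setOf_levelSet_eq]
    exact Finset.finite_toSet _
  measurable := hA.measurable
  support := hA.support
  off_diag i i' hne := (hA.equation i i').mono fun ω h => by rw [h, if_neg hne]
  diag i := (hA.equation i i).mono fun ω h => by rw [h, if_pos rfl]

theorem IsFilterSystem.comp_injective {ι κ : Type*} {E : ι → Set (PontryaginDual Γ)}
    {A : ι → ℕ → PontryaginDual Γ → ℂ} (h : IsFilterSystem μ α m E A) {e : κ → ι}
    (he : Function.Injective e) :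
    IsFilterSystem μ α m (fun k => E (e k)) fun k => A (e k) where
  measurableSet k := h.measurableSet (e k)
  finite ω := (h.finite ω).preimage he.injOn
  measurable k := h.measurable (e k)
  support k := h.support (e k)
  off_diag _ _ hne := h.off_diag _ _ (he.ne hne)
  diag k := h.diag (e k)

/-- Two matrices that satisfy the filter equation and have mutually orthogonal rows compose to a
matrix that satisfies the filter equation. -/
theorem IsFilterSystem.sumElim (hα : 1 < α.range.index) (hc : ∀ ω, dualEnd α (c ω) = ω)
    {ι κ : Type*} {E : ι → Set (PontryaginDual Γ)}
    {A : ι → ℕ → PontryaginDual Γ → ℂ} (hA : IsFilterSystem μ α m E A)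
    {E' : κ → Set (PontryaginDual Γ)} {B : κ → ℕ → PontryaginDual Γ → ℂ}
    (hB : IsFilterSystem μ α m E' B)
    (horth : ∀ k i, ∀ᵐ ω ∂μ, rowProduct α (B k) (A i) ω = 0) :
    IsFilterSystem μ α m (Sum.elim E E') (Sum.elim A B) where
  measurableSet := Sum.rec hA.measurableSet hB.measurableSet
  finite ω := by
    refine (((hA.finite ω).image Sum.inl).union ((hB.finite ω).image Sum.inr)).subset ?_
    rintro (i | k) h
    · exact Or.inl ⟨i, h, rfl⟩
    · exact Or.inr ⟨k, h, rfl⟩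
  measurable := Sum.rec hA.measurable hB.measurable
  support := Sum.rec hA.support hB.support
  off_diag := by
    rintro (i | k) (i' | k') hne
    · exact hA.off_diag i i' fun h => hne (h ▸ rfl)
    · refine (horth k' i).mono fun ω h => ?_
      rw [← rowProduct_conj hα hc]
      exact (congrArg conj h).trans (map_zero _)
    · exact horth k i'
    · exact hB.off_diag k k' fun h => hne (h ▸ rfl)
  diag := Sum.rec hA.diag hB.diag

theorem isFilterSystem_complementary (hm' : Measurable (mTilde α m))
    (hG : IsComplementaryFilter μ α m H G) :
    IsFilterSystem μ α m (fun k : ULift.{u} ℕ => levelSet (mTilde α m) k.down)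
      fun k => G k.down :=
  (isFilterSystem_of_isFilterMatrix hm' hG.filter).comp_injective ULift.down_injective

variable [BorelSpace (PontryaginDual Γ)]

theorem measurable_mTilde (hα : 1 < α.range.index) (hcm : Measurable c)
    (hc : ∀ ω, dualEnd α (c ω) = ω) (hm : Measurable m) : Measurable (mTilde α m) := by
  have := finite_ker_dualEnd α hα
  have := Fintype.ofFinite (dualEnd α).ker
  have h : fiberSum α m = fun ω => ∑ k : (dualEnd α).ker, m (k * c ω) :=
    funext fun ω => finsum_fibre hc m ω
  have h' : Measurable (fiberSum α m) := by
    rw [h]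
    exact Finset.measurable_fun_sum _ fun k _ => hm.comp (measurable_mul_section hcm k)
  exact h'.sub hm

variable [μ.IsHaarMeasure]

/-- The Ruelle operator of a filter system intertwines multiplication by the characters `γ` and
`α γ`. -/
theorem ruelle_charMul {ι : Type*} [Countable ι] {E : ι → Set (PontryaginDual Γ)}
    {A : ι → ℕ → PontryaginDual Γ → ℂ} (h : IsFilterSystem μ α m E A) (hm : Measurable m)
    (hα : 1 < α.range.index) (hcm : Measurable c) (hc : ∀ ω, dualEnd α (c ω) = ω) (γ : Γ)
    (f : L2Sum fun i => μ.restrict (E i)) :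
    ruelle μ α m A (charMul γ f) = charMul (α γ) (ruelle μ α m A f) := by
  have hI := h.isL2Isometry_ruelleFun hm hα hcm hc
  refine L2Sum.ext_ae fun j => ?_
  have hmeas : ∀ i, Measurable fun ω : PontryaginDual Γ => (ω γ : ℂ) * f i ω :=
    fun i => (measurable_eval γ).mul (f.measurable_coe i)
  filter_upwards [hI.coe_toL2Sum_of_ae hmeas (coe_charMul γ f) j,
    coe_charMul (α γ) (ruelle μ α m A f) j, hI.coe_toL2Sum f j] with ω h1 h2 h3
  refine h1.trans (Eq.trans ?_ h2.symm)
  rw [show ruelle μ α m A f j ω = _ from h3, ruelleFun, ruelleFun, ← tsum_mul_left]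
  exact tsum_congr fun i => mul_left_comm _ _ _

/-- The sum of the Ruelle operators of `A` and `B` is the Ruelle operator of the composed matrix. -/
theorem ruelle_add_ruelle {ι κ : Type*} [Countable ι] [Countable κ]
    {E : ι → Set (PontryaginDual Γ)} {A : ι → ℕ → PontryaginDual Γ → ℂ}
    {E' : κ → Set (PontryaginDual Γ)} {B : κ → ℕ → PontryaginDual Γ → ℂ}
    (hA : IsFilterSystem μ α m E A) (hB : IsFilterSystem μ α m E' B)
    (hm : Measurable m) (hα : 1 < α.range.index) (hcm : Measurable c)
    (hc : ∀ ω, dualEnd α (c ω) = ω)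
    (f : L2Sum fun i => μ.restrict (E i)) (g : L2Sum fun k => μ.restrict (E' k))
    {F : ι ⊕ κ → PontryaginDual Γ → ℂ} (hF : ∀ i, Measurable (F i))
    (hf : ∀ i, f i =ᵐ[μ.restrict (E i)] F (.inl i))
    (hg : ∀ k, g k =ᵐ[μ.restrict (E' k)] F (.inr k)) (j : ℕ) :
    (ruelle μ α m A f + ruelle μ α m B g : LevelL2 μ m) j =ᵐ[μ.restrict (levelSet m j)]
      ruelleFun α (Sum.elim A B) F j := by
  filter_upwards [L2Sum.coe_add (ruelle μ α m A f) (ruelle μ α m B g) j,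
    (hA.isL2Isometry_ruelleFun hm hα hcm hc).coe_toL2Sum_of_ae (fun i => hF (.inl i)) hf j,
    (hB.isL2Isometry_ruelleFun hm hα hcm hc).coe_toL2Sum_of_ae (fun k => hF (.inr k)) hg j,
    ae_restrict_of_ae (hA.ae_summable hα hcm hc),
    ae_restrict_of_ae (hB.ae_summable hα hcm hc)] with ω h1 h2 h3 hsA hsB
  rw [h1, show ruelle μ α m A f j ω = _ from h2, show ruelle μ α m B g j ω = _ from h3]
  exact (((hsA j _).hasSum.sum (f := fun i => Sum.elim A B i j ω * F i (dualEnd α ω))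
    (hsB j _).hasSum).tsum_eq).symm

/-- The Ruelle operators of `A` and `B` combine to an isometry if the matrix composed of `A` and
`B` satisfies the filter equation. -/
theorem norm_sq_ruelle_add_ruelle {ι : Type} {κ : Type u} [Countable ι] [Countable κ]
    {E : ι → Set (PontryaginDual Γ)} {A : ι → ℕ → PontryaginDual Γ → ℂ}
    {E' : κ → Set (PontryaginDual Γ)} {B : κ → ℕ → PontryaginDual Γ → ℂ}
    (hA : IsFilterSystem μ α m E A) (hB : IsFilterSystem μ α m E' B)
    (hAB : IsFilterSystem μ α m (Sum.elim E E') (Sum.elim A B)) (hm : Measurable m)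
    (hα : 1 < α.range.index) (hcm : Measurable c) (hc : ∀ ω, dualEnd α (c ω) = ω)
    (f : L2Sum fun i => μ.restrict (E i)) (g : L2Sum fun k => μ.restrict (E' k)) :
    ‖ruelle μ α m A f + ruelle μ α m B g‖ ^ 2 = ‖f‖ ^ 2 + ‖g‖ ^ 2 := by
  have hF : ∀ i, Measurable (Sum.elim (fun i => ⇑(f i)) (fun k => ⇑(g k)) i) :=
    Sum.rec f.measurable_coe g.measurable_coe
  have h1 := energy_congr (ruelle_add_ruelle hA hB hm hα hcm hc f g hF
    (fun _ => .rfl) fun _ => .rfl)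
  rw [(hAB.isL2Isometry_ruelleFun hm hα hcm hc).energy_eq _ hF, ← enorm_sq_eq_energy] at h1
  have h2 : energy (fun i => μ.restrict (Sum.elim E E' i))
      (Sum.elim (fun i => ⇑(f i)) fun k => ⇑(g k)) = ‖f‖ₑ ^ 2 + ‖g‖ₑ ^ 2 := by
    rw [enorm_sq_eq_energy, enorm_sq_eq_energy, energy,
      ENNReal.summable.tsum_sum ENNReal.summable]
    rfl
  rw [h2] at h1
  have h3 := congrArg ENNReal.toReal h1
  rw [ENNReal.toReal_add (by finiteness) (by finiteness)] at h3
  simpa using h3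

/-- If the composed matrix is square almost everywhere, then the Ruelle operators of `A` and `B`
together are onto. -/
theorem exists_ruelle_add_ruelle_eq {ι κ : Type*} [Countable ι] [Countable κ]
    {E : ι → Set (PontryaginDual Γ)} {A : ι → ℕ → PontryaginDual Γ → ℂ}
    {E' : κ → Set (PontryaginDual Γ)} {B : κ → ℕ → PontryaginDual Γ → ℂ}
    (hA : IsFilterSystem μ α m E A) (hB : IsFilterSystem μ α m E' B)
    (hAB : IsFilterSystem μ α m (Sum.elim E E') (Sum.elim A B)) (hm : Measurable m)
    (hα : 1 < α.range.index) (hcm : Measurable c) (hc : ∀ ω, dualEnd α (c ω) = ω)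
    (hcard : ∀ᵐ ω ∂μ, (hAB.finite ω).toFinset.card = fiberSum α m ω) (u : LevelL2 μ m) :
    ∃ (f : L2Sum fun i => μ.restrict (E i)) (g : L2Sum fun k => μ.restrict (E' k)),
      ruelle μ α m A f + ruelle μ α m B g = u := by
  obtain ⟨F, hF, hFu⟩ := hAB.exists_ruelleFun_eq hm hα hcm hc hcard (fun j => u j)
    u.measurable_coe
  have h1 := (hAB.isL2Isometry_ruelleFun hm hα hcm hc).energy_eq F hF
  rw [energy_congr hFu] at h1
  have h2 : (∑' i, ∫⁻ x, ‖F (.inl i) x‖ₑ ^ 2 ∂μ.restrict (E i)) +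
      ∑' k, ∫⁻ x, ‖F (.inr k) x‖ₑ ^ 2 ∂μ.restrict (E' k) < ∞ :=
    (h1.trans (ENNReal.summable.tsum_sum ENNReal.summable)).symm.trans_lt (energy_coe_lt_top u)
  obtain ⟨f, hf⟩ := exists_coe_eq (ν := fun i => μ.restrict (E i))
    (fun i => (hF (.inl i)).aemeasurable) (le_self_add.trans_lt h2)
  obtain ⟨g, hg⟩ := exists_coe_eq (ν := fun k => μ.restrict (E' k))
    (fun k => (hF (.inr k)).aemeasurable) (le_add_self.trans_lt h2)
  exact ⟨f, g, L2Sum.ext_ae fun j =>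
    (ruelle_add_ruelle hA hB hm hα hcm hc f g hF hf hg j).trans (hFu j)⟩

/-- The Ruelle operator of `H` maps `Cᵢ` to the `i`-th row of `H`. -/
theorem ruelle_unitElement [IsFiniteMeasure μ] (hm : Measurable m)
    (hsys : IsFilterSystem μ α m (levelSet m) H) (hα : 1 < α.range.index)
    (hcm : Measurable c) (hc : ∀ ω, dualEnd α (c ω) = ω) (i j : ℕ) :
    ruelle μ α m H (unitElement μ m i) j =ᵐ[μ.restrict (levelSet m j)] H i j := by
  have := finite_ker_dualEnd α hα
  have := Fintype.ofFinite (dualEnd α).ker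
  have hmeas : ∀ l, Measurable
      (if l = i then (levelSet m i).indicator 1 else 0 : PontryaginDual Γ → ℂ) := fun l => by
    split_ifs
    · exact measurable_one.indicator (measurableSet_levelSet hm i)
    · exact measurable_zero
  -- the `i`-th row vanishes on the fibres over the points outside `σ_i`
  have hrow : ∀ᵐ ζ ∂μ, dualEnd α ζ ∉ levelSet m i → H i j ζ = 0 := by
    refine ae_of_ae_forall_fibre hc ?_
    filter_upwards [hsys.ae_isFilterFibre hα hcm hc] with ω hω k hk
    rw [dualEnd_mul_section hc] at hk
    exact hω.apply_eq_zero hc (by simpa using hk) k j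
  filter_upwards [(hsys.isL2Isometry_ruelleFun hm hα hcm hc).coe_toL2Sum_of_ae hmeas
    (coe_unitElement hm i) j, ae_restrict_of_ae hrow] with ζ h1 h2
  refine h1.trans ?_
  rw [ruelleFun, tsum_eq_single i fun l hl => by simp [hl], if_pos rfl]
  by_cases h : dualEnd α ζ ∈ levelSet m i
  · rw [Set.indicator_of_mem h, Pi.one_apply, mul_one]
  · rw [h2 h, zero_mul]

end Filters

/-! ### The canonical Hilbert space and its multiresolution analysis -/

section Canonical

variable {Γ : Type u} [CommGroup Γ] [TopologicalSpace Γ] [DiscreteTopology Γ]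
  [MeasurableSpace (PontryaginDual Γ)]
  {μ : Measure (PontryaginDual Γ)} {α : Γ →* Γ} {c : PontryaginDual Γ → PontryaginDual Γ}
  {m : PontryaginDual Γ → ℕ}

theorem isFiniteMeasure_dilMeasure {ι : Type v} (ν : ι → Measure (PontryaginDual Γ))
    (hν : ∀ i, IsFiniteMeasure (ν i)) (p : ι × (dualEnd α).ker) :
    IsFiniteMeasure (dilMeasure α c ν p) := by
  have := hν p.1
  exact Measure.smul_finite _ (ENNReal.natCast_ne_top _)

theorem isFiniteMeasure_wFamily [IsFiniteMeasure μ] (n : ℕ) (i : (wFamily μ α c m n).Idx) :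
    IsFiniteMeasure ((wFamily μ α c m n).meas i) := by
  induction n with
  | zero => exact inferInstanceAs (IsFiniteMeasure (μ.restrict _))
  | succ n ih => exact isFiniteMeasure_dilMeasure _ ih i

theorem countable_wFamily (hα : 1 < α.range.index) (n : ℕ) :
    Countable (wFamily μ α c m n).Idx := by
  have := finite_ker_dualEnd α hα
  induction n with
  | zero => exact inferInstanceAs (Countable (ULift ℕ))
  | succ n ih => exact inferInstanceAs (Countable (_ × (dualEnd α).ker))

theorem separableSpace_L2Sum {X : Type u} [MeasurableSpace X]
    [MeasurableSpace.CountablyGenerated X] {ι : Type v} [Countable ι]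
    (ν : ι → Measure X) (hν : ∀ i, IsFiniteMeasure (ν i)) :
    TopologicalSpace.SeparableSpace (L2Sum ν) := by
  have : Fact ((2 : ℝ≥0∞) ≠ ∞) := ⟨by norm_num⟩
  exact separableSpace_lp

theorem separableSpace_HSpace [Countable Γ] [BorelSpace (PontryaginDual Γ)] [IsFiniteMeasure μ]
    (hα : 1 < α.range.index) : TopologicalSpace.SeparableSpace (HSpace μ α c m) := by
  have h1 : TopologicalSpace.SeparableSpace (LevelL2 μ m) :=
    separableSpace_L2Sum _ fun i => inferInstance
  have h2 : ∀ n, TopologicalSpace.SeparableSpace (WSpace μ α c m n) := fun n =>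
    have := countable_wFamily (μ := μ) (c := c) (m := m) hα n
    separableSpace_L2Sum _ (isFiniteMeasure_wFamily n)
  exact separableSpace_prodLp

theorem HSpace.ext {f g : HSpace μ α c m} (h1 : f.fst = g.fst)
    (h2 : ∀ n, f.snd n = g.snd n) : f = g :=
  prodLp_ext h1 h2

theorem mem_coreSubspace {f : HSpace μ α c m} : f ∈ coreSubspace μ α c m ↔ f.snd = 0 := Iff.rfl

/-- Membership in `𝒱ⱼ = T⁻ʲ(𝒱₀)`, in terms of `Tʲ`. -/
theorem mem_dilateCore {T : HSpace μ α c m ≃ₗᵢ[ℂ] HSpace μ α c m} {j : ℤ}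
    {f : HSpace μ α c m} : f ∈ dilateCore μ α c m T j ↔ (T ^ j) f ∈ coreSubspace μ α c m := by
  have h : ∀ (i : ℤ) (g : HSpace μ α c m), (T ^ (-i)) ((T ^ i) g) = g := fun i g => by
    rw [← linearIsometryEquiv_mul_apply, ← zpow_add, neg_add_cancel,
      linearIsometryEquiv_zpow_zero_apply]
  constructor
  · rintro ⟨g, hg, rfl⟩
    have := h (-j) g
    rw [neg_neg] at this
    exact this.symm ▸ hg
  · exact fun hf => ⟨_, hf, h j f⟩

theorem isClosed_coreSubspace : IsClosed (coreSubspace μ α c m : Set (HSpace μ α c m)) := by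
  have h : Continuous fun f : HSpace μ α c m => f.snd :=
    continuous_snd.comp (WithLp.prod_continuous_ofLp 2 _ _)
  exact isClosed_singleton.preimage h

/-- The core subspace as the space `⨁ᵢ L²(σᵢ)`. -/
def coreEquiv (T : HSpace μ α c m ≃ₗᵢ[ℂ] HSpace μ α c m) :
    dilateCore μ α c m T 0 ≃ₗᵢ[ℂ] LevelL2 μ m :=
  fstEquiv _ fun f => by
    rw [mem_dilateCore, linearIsometryEquiv_zpow_zero_apply, mem_coreSubspace]

theorem coe_coreEquiv (T : HSpace μ α c m ≃ₗᵢ[ℂ] HSpace μ α c m) (f) :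
    coreEquiv T f = (f : HSpace μ α c m).fst := rfl

section Shift

variable {T : HSpace μ α c m ≃ₗᵢ[ℂ] HSpace μ α c m} {S : LevelL2 μ m → LevelL2 μ m}
  {D : ∀ n, WSpace μ α c m n ≃ₗᵢ[ℂ] WSpace μ α c m (n + 1)}

theorem apply_mem_coreSubspace
    (hTD : ∀ f n, (T f).snd n = (D n).symm (f.snd (n + 1)))
    {f : HSpace μ α c m} (hf : f ∈ coreSubspace μ α c m) : T f ∈ coreSubspace μ α c m := by
  refine mem_coreSubspace.2 (lp.ext (funext fun n => ?_))
  rw [hTD, mem_coreSubspace.1 hf]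
  exact map_zero (D n).symm

theorem iterate_of_mem_coreSubspace
    (hTD : ∀ f n, (T f).snd n = (D n).symm (f.snd (n + 1)))
    (hTS : ∀ f ∈ coreSubspace μ α c m, (T f).fst = S f.fst) (n : ℕ)
    {f : HSpace μ α c m} (hf : f ∈ coreSubspace μ α c m) :
    (T ^ n) f ∈ coreSubspace μ α c m ∧ ((T ^ n) f).fst = S^[n] f.fst := by
  induction n with
  | zero => exact ⟨hf, rfl⟩
  | succ n ih =>
    rw [pow_succ', linearIsometryEquiv_mul_apply, Function.iterate_succ_apply', ← ih.2]
    exact ⟨apply_mem_coreSubspace hTD ih.1, hTS _ ih.1⟩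

/-- The operator `T` shifts `𝒲ₙ₊₁` to `𝒲ₙ` and maps `𝒲₀` to `𝒱₀`. -/
theorem pow_apply_mem_coreSubspace
    (hTD : ∀ f n, (T f).snd n = (D n).symm (f.snd (n + 1))) (N : ℕ) {f : HSpace μ α c m}
    (hf : ∀ n, N ≤ n → f.snd n = 0) : (T ^ N) f ∈ coreSubspace μ α c m := by
  induction N generalizing f with
  | zero => exact mem_coreSubspace.2 (lp.ext (funext fun n => hf n n.zero_le))
  | succ N ih =>
    rw [pow_succ, linearIsometryEquiv_mul_apply]
    exact ih fun n hn => by rw [hTD, hf _ (by omega), map_zero]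

/-- The subspaces `T⁻ʲ(𝒱₀)` form a generalized multiresolution analysis if `T` acts on `𝒱₀` as a
pure isometry and shifts the spaces `𝒲ₙ`. -/
theorem isGMRA_dilateCore [TopologicalSpace.SeparableSpace (HSpace μ α c m)]
    {π : Γ →* (HSpace μ α c m ≃ₗᵢ[ℂ] HSpace μ α c m)}
    (hTD : ∀ f n, (T f).snd n = (D n).symm (f.snd (n + 1)))
    (hTS : ∀ f ∈ coreSubspace μ α c m, (T f).fst = S f.fst)
    (hS : ∀ v, (∀ n : ℕ, v ∈ Set.range (S^[n])) → v = 0)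
    (hπ : ∀ γ, ∀ f ∈ coreSubspace μ α c m, π γ f ∈ coreSubspace μ α c m) :
    IsGMRA π T⁻¹ (dilateCore μ α c m T) where
  separable := inferInstance
  closed j := by
    have h : (dilateCore μ α c m T j : Set (HSpace μ α c m)) =
        (T ^ j) ⁻¹' (coreSubspace μ α c m : Set (HSpace μ α c m)) :=
      Set.ext fun f => mem_dilateCore
    rw [h]
    exact isClosed_coreSubspace.preimage (T ^ j).continuous
  mono j f hf := by
    rw [mem_dilateCore] at hf ⊢
    rw [add_comm, zpow_one_add, linearIsometryEquiv_mul_apply]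
    exact apply_mem_coreSubspace hTD hf
  dilate j := by
    have h : ∀ f, f ∈ dilateCore μ α c m T (j + 1) ↔ T f ∈ dilateCore μ α c m T j := fun f => by
      rw [mem_dilateCore, mem_dilateCore, zpow_add_one, linearIsometryEquiv_mul_apply]
    ext f
    refine (h f).trans ⟨fun hf => ⟨T f, hf, T.symm_apply_apply f⟩, ?_⟩
    rintro ⟨g, hg, rfl⟩
    exact (T.apply_symm_apply g).symm ▸ hg
  inter f hf := by
    have h0 : f ∈ coreSubspace μ α c m := by simpa [mem_dilateCore] using hf 0
    refine prodLp_ext (hS _ fun n => ?_) fun n => by rw [mem_coreSubspace.1 h0]; rfl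
    have hn := mem_dilateCore.1 (hf (-n))
    -- `f = T ^ n g` with `g = T ^ (-n) f` in `𝒱₀`
    refine ⟨_, (iterate_of_mem_coreSubspace hTD hTS n hn).2.symm.trans ?_⟩
    rw [← zpow_natCast, ← linearIsometryEquiv_mul_apply, ← zpow_add, add_neg_cancel,
      linearIsometryEquiv_zpow_zero_apply]
  dense := by
    refine dense_setOf_eventually_zero.mono ?_
    rintro f ⟨N, hN⟩
    refine Set.mem_iUnion.2 ⟨N, mem_dilateCore.2 ?_⟩
    rw [zpow_natCast]
    exact pow_apply_mem_coreSubspace hTD N hN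
  invariant γ f hf := by
    rw [mem_dilateCore, linearIsometryEquiv_zpow_zero_apply] at hf ⊢
    exact hπ γ f hf

end Shift

/-- The representation `π` of `Γ` on `ℋ` by multiplication by characters. -/
theorem exists_charMul_rep [BorelSpace (PontryaginDual Γ)] :
    ∃ π : Γ →* (HSpace μ α c m ≃ₗᵢ[ℂ] HSpace μ α c m), ∀ γ f,
      (π γ f).fst = charMul γ f.fst ∧ ∀ n, (π γ f).snd n = charMul γ (f.snd n) := by
  have h := fun γ : Γ => exists_diagonal_equiv (V := LevelL2 μ m) (W := WSpace μ α c m)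
    (charMulEquiv _ γ) fun n => charMulEquiv _ γ
  choose p hp using h
  have hp1 : ∀ γ f, (p γ f).fst = charMul γ f.fst := fun γ f => (hp γ f).1
  have hp2 : ∀ γ f n, (p γ f).snd n = charMul γ (f.snd n) := fun γ f n => (hp γ f).2 n
  have hmul : ∀ γ γ', p (γ * γ') = p γ * p γ' := fun γ γ' =>
    LinearIsometryEquiv.ext fun f => HSpace.ext
      (by rw [linearIsometryEquiv_mul_apply, hp1, hp1, hp1, charMul_mul])
      fun n => by rw [linearIsometryEquiv_mul_apply, hp2, hp2, hp2, charMul_mul]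
  exact ⟨MonoidHom.mk' p hmul, fun γ f => ⟨hp1 γ f, hp2 γ f⟩⟩

/-- The operator `T` on the canonical Hilbert space is unitary. -/
theorem exists_canonical_operator [Countable Γ] [BorelSpace (PontryaginDual Γ)]
    [μ.IsHaarMeasure] (hα : 1 < α.range.index) (hcm : Measurable c)
    (hc : ∀ ω, dualEnd α (c ω) = ω) (hm : IsMultiplicityFunction μ α m)
    {H G : ℕ → ℕ → PontryaginDual Γ → ℂ} (hH : IsFilter μ α m H)
    (hG : IsComplementaryFilter μ α m H G)
    (D : ∀ n, WSpace μ α c m n ≃ₗᵢ[ℂ] WSpace μ α c m (n + 1)) :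
    ∃ T : HSpace μ α c m ≃ₗᵢ[ℂ] HSpace μ α c m, ∀ f,
      (T f).fst = ruelle μ α m H f.fst +
        ruelle μ α m (fun k : (wFamily μ α c m 0).Idx => G k.down) (f.snd 0) ∧
      ∀ n, (T f).snd n = (D n).symm (f.snd (n + 1)) := by
  have hmm := hm.measurable
  have hsH := isFilterSystem_of_isFilterMatrix hmm hH
  have hsG := isFilterSystem_complementary (measurable_mTilde hα hcm hc hmm) hG
  have hsHG := hsH.sumElim hα hc hsG fun k i => hG.orthogonal k.down i
  have hcard : ∀ᵐ ω ∂μ, (hsHG.finite ω).toFinset.card = fiberSum α m ω := by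
    filter_upwards [hm.le_fiberSum] with ω hω
    rw [ncard_rows, mTilde]
    omega
  let S := (hsH.isL2Isometry_ruelleFun hmm hα hcm hc).toLinearIsometry
  let R := (hsG.isL2Isometry_ruelleFun hmm hα hcm hc).toLinearIsometry
  have hnorm : ∀ v w, ‖S v + R w‖ ^ 2 = ‖v‖ ^ 2 + ‖w‖ ^ 2 :=
    norm_sq_ruelle_add_ruelle hsH hsG hsHG hmm hα hcm hc
  have hsurj : ∀ u, ∃ v w, S v + R w = u :=
    exists_ruelle_add_ruelle_eq hsH hsG hsHG hmm hα hcm hc hcard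
  exact exists_shift_equiv (W := WSpace μ α c m) S.toLinearMap R.toLinearMap D hnorm hsurj

/-- The operator `T` intertwines `π_γ` and `π_{α γ}`. -/
theorem canonical_operator_rep [Countable Γ] [BorelSpace (PontryaginDual Γ)]
    [μ.IsHaarMeasure] (hα : 1 < α.range.index) (hcm : Measurable c)
    (hc : ∀ ω, dualEnd α (c ω) = ω) (hm : IsMultiplicityFunction μ α m)
    {H G : ℕ → ℕ → PontryaginDual Γ → ℂ} (hH : IsFilter μ α m H)
    (hG : IsComplementaryFilter μ α m H G)
    {D : ∀ n, WSpace μ α c m n ≃ₗᵢ[ℂ] WSpace μ α c m (n + 1)}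
    (hD : ∀ n f, D n f = wDilation μ α c m n f)
    {π : Γ →* (HSpace μ α c m ≃ₗᵢ[ℂ] HSpace μ α c m)}
    (hπ : ∀ γ f, (π γ f).fst = charMul γ f.fst ∧ ∀ n, (π γ f).snd n = charMul γ (f.snd n))
    {T : HSpace μ α c m ≃ₗᵢ[ℂ] HSpace μ α c m}
    (hT : ∀ f, (T f).fst = ruelle μ α m H f.fst +
        ruelle μ α m (fun k : (wFamily μ α c m 0).Idx => G k.down) (f.snd 0) ∧
      ∀ n, (T f).snd n = (D n).symm (f.snd (n + 1)))
    (γ : Γ) (f : HSpace μ α c m) : T (π γ f) = π (α γ) (T f) := by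
  have hmm := hm.measurable
  have hsH := isFilterSystem_of_isFilterMatrix hmm hH
  have hsG := isFilterSystem_complementary (measurable_mTilde hα hcm hc hmm) hG
  have h0 : ruelle μ α m (fun k : (wFamily μ α c m 0).Idx => G k.down) (charMul γ (f.snd 0)) =
      charMul (α γ)
        (ruelle μ α m (fun k : (wFamily μ α c m 0).Idx => G k.down) (f.snd 0)) :=
    ruelle_charMul hsG hmm hα hcm hc γ (f.snd 0)
  refine HSpace.ext ?_ fun n => ?_
  · rw [(hπ _ _).1, (hT _).1, (hT _).1, (hπ γ f).1, (hπ γ f).2 0, h0,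
      ruelle_charMul hsH hmm hα hcm hc]
    exact (map_add (charMulEquiv _ (α γ)) _ _).symm
  · rw [(hT _).2, (hπ _ _).2, (hπ _ _).2, (hT _).2, LinearIsometryEquiv.symm_apply_eq, hD]
    refine Eq.trans ?_ (dilation_charMul hα hcm hc _ γ _).symm
    exact congrArg (charMul γ) ((hD n _).symm.trans ((D n).apply_symm_apply _)).symm

theorem ruelle_zero [BorelSpace (PontryaginDual Γ)] [μ.IsHaarMeasure] {ι : Type v} [Countable ι]
    {E : ι → Set (PontryaginDual Γ)}
    {A : ι → ℕ → PontryaginDual Γ → ℂ} (h : IsFilterSystem μ α m E A) (hm : Measurable m)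
    (hα : 1 < α.range.index) (hcm : Measurable c) (hc : ∀ ω, dualEnd α (c ω) = ω) :
    ruelle μ α m A (0 : L2Sum fun i => μ.restrict (E i)) = 0 :=
  map_zero (h.isL2Isometry_ruelleFun hm hα hcm hc).toLinearIsometry

/-- On `𝒱₀` the operator `T` is the Ruelle operator of `H`. -/
theorem canonical_operator_fst [BorelSpace (PontryaginDual Γ)]
    [μ.IsHaarMeasure] (hα : 1 < α.range.index) (hcm : Measurable c)
    (hc : ∀ ω, dualEnd α (c ω) = ω) (hm : IsMultiplicityFunction μ α m)
    {H G : ℕ → ℕ → PontryaginDual Γ → ℂ} (hG : IsComplementaryFilter μ α m H G)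
    {f : HSpace μ α c m} {u : LevelL2 μ m}
    (hu : u = ruelle μ α m H f.fst +
      ruelle μ α m (fun k : (wFamily μ α c m 0).Idx => G k.down) (f.snd 0))
    (hf : f ∈ coreSubspace μ α c m) : u = ruelle μ α m H f.fst := by
  have h0 := ruelle_zero
    (isFilterSystem_complementary (measurable_mTilde hα hcm hc hm.measurable) hG)
    hm.measurable hα hcm hc
  rw [hu, mem_coreSubspace.1 hf]
  exact (congrArg (ruelle μ α m H f.fst + ·) h0).trans (add_zero _)

theorem charMul_mem_coreSubspace [BorelSpace (PontryaginDual Γ)] {γ : Γ} {f g : HSpace μ α c m}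
    (hg : ∀ n, g.snd n = charMul γ (f.snd n)) (hf : f ∈ coreSubspace μ α c m) :
    g ∈ coreSubspace μ α c m := by
  refine mem_coreSubspace.2 (lp.ext (funext fun n => ?_))
  rw [hg, mem_coreSubspace.1 hf]
  exact map_zero (charMulEquiv _ γ)

/-- On `𝒱₀` the representation `π` already is multiplication by characters. -/
theorem isStoneMap_coreEquiv [BorelSpace (PontryaginDual Γ)]
    {π : Γ →* (HSpace μ α c m ≃ₗᵢ[ℂ] HSpace μ α c m)}
    (hπ : ∀ γ f, (π γ f).fst = charMul γ f.fst ∧ ∀ n, (π γ f).snd n = charMul γ (f.snd n))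
    (T : HSpace μ α c m ≃ₗᵢ[ℂ] HSpace μ α c m) :
    IsStoneMap μ m π (dilateCore μ α c m T 0) (coreEquiv T) := by
  intro γ f
  have hf : π γ f ∈ dilateCore μ α c m T 0 := by
    have h := f.2
    rw [mem_dilateCore, linearIsometryEquiv_zpow_zero_apply] at h ⊢
    exact charMul_mem_coreSubspace (hπ γ f).2 h
  refine ⟨⟨_, hf⟩, rfl, fun i => ?_⟩
  rw [coe_coreEquiv, (hπ γ f).1]
  exact coe_charMul γ _ i

/-- The operator `δ⁻¹ = T` maps `Cᵢ` to `S_H Cᵢ`, the `i`-th row of `H`. -/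
theorem isFilterConstructedFrom_dilateCore [BorelSpace (PontryaginDual Γ)]
    [IsFiniteMeasure μ] [μ.IsHaarMeasure] (hα : 1 < α.range.index) (hcm : Measurable c)
    (hc : ∀ ω, dualEnd α (c ω) = ω) (hm : IsMultiplicityFunction μ α m)
    {H : ℕ → ℕ → PontryaginDual Γ → ℂ} (hH : IsFilter μ α m H)
    {D : ∀ n, WSpace μ α c m n ≃ₗᵢ[ℂ] WSpace μ α c m (n + 1)}
    {π : Γ →* (HSpace μ α c m ≃ₗᵢ[ℂ] HSpace μ α c m)}
    {T : HSpace μ α c m ≃ₗᵢ[ℂ] HSpace μ α c m}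
    (hTD : ∀ f n, (T f).snd n = (D n).symm (f.snd (n + 1)))
    (hTS : ∀ f ∈ coreSubspace μ α c m, (T f).fst = ruelle μ α m H f.fst)
    (hJ : IsStoneMap μ m π (dilateCore μ α c m T 0) (coreEquiv T)) :
    IsFilterConstructedFrom μ π T⁻¹ (dilateCore μ α c m T) m H := by
  refine ⟨_, hJ, fun i => ?_⟩
  have hC : ((coreEquiv T).symm (unitElement μ m i) : HSpace μ α c m) ∈
      coreSubspace μ α c m := rfl
  have hg : T ((coreEquiv T).symm (unitElement μ m i)) ∈ dilateCore μ α c m T 0 := by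
    rw [mem_dilateCore, linearIsometryEquiv_zpow_zero_apply]
    exact apply_mem_coreSubspace hTD hC
  refine ⟨⟨_, hg⟩, rfl, fun j => ?_⟩
  rw [coe_coreEquiv, hTS _ hC]
  exact ruelle_unitElement hm.measurable (isFilterSystem_of_isFilterMatrix hm.measurable hH)
    hα hcm hc i j

end Canonical

end GMRA

end

open GMRA
theorem mainTheorem2 {Γ : Type*} [CommGroup Γ] [Countable Γ]
    [TopologicalSpace Γ] [DiscreteTopology Γ]
    [MeasurableSpace (PontryaginDual Γ)] [BorelSpace (PontryaginDual Γ)]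
    (μ : Measure (PontryaginDual Γ)) [μ.IsHaarMeasure]
    (α : Γ →* Γ) (hα_inj : Function.Injective α) (hα_index : 1 < α.range.index)
    (hα_inter : ∀ γ : Γ, (∀ n : ℕ, γ ∈ Set.range (α^[n])) → γ = 1)
    (c : PontryaginDual Γ → PontryaginDual Γ) (hc_meas : Measurable c)
    (hc : ∀ ω, dualEnd α (c ω) = ω)
    (m : PontryaginDual Γ → ℕ) (hm : IsMultiplicityFunction μ α m)
    (H : ℕ → ℕ → PontryaginDual Γ → ℂ) (hH : IsFilter μ α m H)
    (hS : IsPureIsometry (fun f : LevelL2 μ m => ruelle μ α m H f))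
    (G : ℕ → ℕ → PontryaginDual Γ → ℂ) (hG : IsComplementaryFilter μ α m H G) :
    ∃ (D : ∀ n, WSpace μ α c m n ≃ₗᵢ[ℂ] WSpace μ α c m (n + 1))
      (π : Γ →* (HSpace μ α c m ≃ₗᵢ[ℂ] HSpace μ α c m))
      (T : HSpace μ α c m ≃ₗᵢ[ℂ] HSpace μ α c m),
      (∀ n f, D n f = wDilation μ α c m n f) ∧
      (∀ γ f, (π γ f).fst = charMul γ f.fst ∧ ∀ n, (π γ f).snd n = charMul γ (f.snd n)) ∧
      (∀ f, (T f).fst =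
          ruelle μ α m H f.fst +
            ruelle μ α m (fun k : (wFamily μ α c m 0).Idx => G k.down) (f.snd 0) ∧
        ∀ n, (T f).snd n = (D n).symm (f.snd (n + 1))) ∧
      (∀ γ, T * π γ * T⁻¹ = π (α γ)) ∧
      IsGMRA π T⁻¹ (dilateCore μ α c m T) ∧
      HasMultiplicityFunction μ π (dilateCore μ α c m T) m ∧
      IsFilterConstructedFrom μ π T⁻¹ (dilateCore μ α c m T) m H := by
  let D : ∀ n, WSpace μ α c m n ≃ₗᵢ[ℂ] WSpace μ α c m (n + 1) := fun n =>
    dilationEquiv hα_index hc_meas hc (wFamily μ α c m n).meas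
  have hD : ∀ n f, D n f = wDilation μ α c m n f := fun _ _ => rfl
  clear_value D
  refine (exists_charMul_rep (μ := μ) (α := α) (c := c) (m := m)).elim fun π hπ => ?_
  refine (exists_canonical_operator hα_index hc_meas hc hm hH hG D).elim fun T hT => ?_
  have hTD : ∀ f n, (T f).snd n = (D n).symm (f.snd (n + 1)) := fun f => (hT f).2
  have hTS : ∀ f ∈ coreSubspace μ α c m, (T f).fst = ruelle μ α m H f.fst :=
    fun f hf => canonical_operator_fst hα_index hc_meas hc hm hG ((hT f).1) hf
  have hfin : IsFiniteMeasure μ := inferInstance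
  have hsep := separableSpace_HSpace (μ := μ) (c := c) (m := m) hα_index
  have hπc : ∀ γ, ∀ f ∈ coreSubspace μ α c m, π γ f ∈ coreSubspace μ α c m :=
    fun γ f hf => charMul_mem_coreSubspace (hπ γ f).2 hf
  have hJ := isStoneMap_coreEquiv hπ T
  exact ⟨D, π, T, hD, hπ, hT,
    fun γ => mul_inv_eq_iff_eq_mul.2 <| LinearIsometryEquiv.ext <|
      canonical_operator_rep hα_index hc_meas hc hm hH hG hD hπ hT γ,
    isGMRA_dilateCore hTD hTS hS.2 hπc, ⟨hm.measurable, _, hJ⟩,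
    isFilterConstructedFrom_dilateCore hα_index hc_meas hc hm hH hTD hTS hJ⟩
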